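/- Let $R$ be an integer with $|R|>1$, let $B\subset\mathbb{Z}$ be a finite set with $0\in B$ and $|B|=N$, and let $\mu_B$ be the invariant measure of the iterated function system $\tau_b(x)=R^{-1}(x+b)$, $b\in B$, on $\mathbb{R}$, i.e. the unique Borel probability measure with $\int f\,d\mu_B=\frac1N\sum_{b\in B}\int f\circ\tau_b\,d\mu_B$ for all bounded Borel functions $f$. Let $l_0,\dots,l_{N-1}\in\mathbb{Z}$ with $l_0=0$ be such that the matrix $$\frac{1}{\sqrt N}\left(e^{2\pi i R^{-1}b\, l_i}\right)_{i\in\{0,\dots,N-1\},\,b\in B}$$ is unitary. Put $e_t(x)=e^{2\pi i t x}$, $m_B(t)=\frac1N\sum_{b\in B}e^{2\pi i b t}$, $g_i(t)=R^{-1}(t-l_i)$ and $\nu_i(t)=m_B(g_i(t))$ for $t,x\in\mathbb{R}$. For a finite (possibly empty) word $\omega=\omega_1\dots\omega_n$ over $\{0,\dots,N-1\}$ put $g_\omega=g_{\omega_n}\circ\dots\circ g_{\omega_1}$ and $\nu_\omega(t)=\prod_{k=1}^{n}\nu_{\omega_k}(g_{\omega_1\dots\omega_{k-1}}(t))$. A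 set $M\subseteq\mathbb{R}$ is invariant if $g_i(t)\in M$ whenever $t\in M$ and $\nu_i(t)\neq0$; a minimal invariant set is a nonempty invariant set that has no nonempty proper invariant subset. A nonempty word $\beta$ is a cycle word for $c\in\mathbb{R}$ if $g_\beta(c)=c$, $\nu_\beta(c)\neq0$, and $g_\gamma(c)\neq c$ for every nonempty proper initial subword $\gamma$ of $\beta$. Let $\Omega_c^{(0)}$ be the set of all finite words (including the empty word) that do not end in a cycle word for $c$. Then there are only finitely many minimal invariant sets $M_1,\dots,M_p$, and for every choice of points $c_j\in M_j$, $j=1,\dots,p$, the family of exponential functions $$\left\{e_{l_{\omega_1}+R l_{\omega_2}+\dots+R^{n-1}l_{\omega_n}+R^n c_j} : \omega=\omega_1\dots\omega_n\in\Omega_{c_j}^{(0)},\ j=1,\dots,p\right\}$$ is an orthonormal basis of $L^2(\mu_B)$. -/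

import Mathlib

open MeasureTheory

namespace FractalFourier

noncomputable section

/-! ### The affine iterated function system and its invariant measure -/

/-- The maps `τ_b(x) = R⁻¹ (x + b)` of the iterated function system on `ℝ`. -/
def tau (R b : ℤ) (x : ℝ) : ℝ := (x + b) / R

/-- `μ` is an invariant Borel probability measure of the system `(τ_b)_{b ∈ B}`:
`∫ f dμ = (1/N) ∑_{b ∈ B} ∫ f ∘ τ_b dμ` for all bounded Borel functions `f`, with `N = |B|`. -/
structure IsInvariantMeasure (R : ℤ) (B : Finset ℤ) (μ : Measure ℝ) : Prop where
  isProbabilityMeasure : IsProbabilityMeasure μ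
  integral_eq : ∀ f : ℝ → ℂ, Measurable f → (∃ C : ℝ, ∀ x, ‖f x‖ ≤ C) →
    ∫ x, f x ∂μ = (1 / (B.card : ℂ)) * ∑ b ∈ B, ∫ x, f (tau R b x) ∂μ

/-- The invariant measure `μ_B`: the unique invariant Borel probability measure. Existence and
uniqueness (for `|R| > 1` and `B` nonempty) are `existsUnique_isInvariantMeasure`. -/
def invariantMeasure (R : ℤ) (B : Finset ℤ) : Measure ℝ :=
  Classical.epsilon (IsInvariantMeasure R B)

/-! ### Exponentials, transition weights and words -/

/-- The exponential function `e_t(x) = e^{2π i t x}`. -/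
def expFun (t x : ℝ) : ℂ := Complex.exp (2 * Real.pi * Complex.I * t * x)

/-- The matrix `N^{-1/2} (e^{2π i R⁻¹ b l_i})`, with rows `i = 0, …, N - 1` and columns `b ∈ B`. -/
def hadamardMatrix {N : ℕ} (R : ℤ) (B : Finset ℤ) (l : Fin N → ℤ) : Matrix (Fin N) B ℂ :=
  fun i b => (1 / (Real.sqrt N : ℂ)) *
    Complex.exp (2 * Real.pi * Complex.I * ((R : ℂ)⁻¹ * ((b : ℤ) : ℂ) * (l i : ℂ)))

/-- `m_B(t) = (1/N) ∑_{b ∈ B} e^{2π i b t}`. -/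
def mB (B : Finset ℤ) (t : ℝ) : ℂ :=
  (1 / (B.card : ℂ)) * ∑ b ∈ B, expFun b t

/-- The maps `g_i(t) = R⁻¹ (t - l_i)`. -/
def g {N : ℕ} (R : ℤ) (l : Fin N → ℤ) (i : Fin N) (t : ℝ) : ℝ := (t - l i) / R

/-- The weights `ν_i(t) = m_B(g_i(t))`; the transition from `t` to `g_i(t)` is possible when
`ν_i(t) ≠ 0`. -/
def nu {N : ℕ} (R : ℤ) (B : Finset ℤ) (l : Fin N → ℤ) (i : Fin N) (t : ℝ) : ℂ :=
  mB B (g R l i t)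

/-- `g_ω = g_{ω_n} ∘ ⋯ ∘ g_{ω_1}` for a finite word `ω = ω_1 … ω_n`. -/
def gWord {N : ℕ} (R : ℤ) (l : Fin N → ℤ) : List (Fin N) → ℝ → ℝ
  | [], t => t
  | i :: ω, t => gWord R l ω (g R l i t)

/-- `ν_ω(t) = ν_{ω_1}(t) ν_{ω_2}(g_{ω_1}(t)) ⋯ ν_{ω_n}(g_{ω_{n-1}} ⋯ g_{ω_1}(t))`. -/
def nuWord {N : ℕ} (R : ℤ) (B : Finset ℤ) (l : Fin N → ℤ) : List (Fin N) → ℝ → ℂ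
  | [], _ => 1
  | i :: ω, t => nu R B l i t * nuWord R B l ω (g R l i t)

/-- A set is invariant if it contains the endpoint of every possible transition from its points. -/
def IsInvariant {N : ℕ} (R : ℤ) (B : Finset ℤ) (l : Fin N → ℤ) (M : Set ℝ) : Prop :=
  ∀ t ∈ M, ∀ i, nu R B l i t ≠ 0 → g R l i t ∈ M

/-- Minimal invariant sets: minimal among the nonempty invariant subsets of `ℝ`. -/
def IsMinimalInvariant {N : ℕ} (R : ℤ) (B : Finset ℤ) (l : Fin N → ℤ) (M : Set ℝ) : Prop :=
  Minimal (fun M' : Set ℝ => M'.Nonempty ∧ IsInvariant R B l M') M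

/-- `β` is a cycle word for `c`: it is nonempty, `g_β(c) = c`, no nonempty proper initial part of
`β` takes `c` back to `c`, and `ν_β(c) ≠ 0`. -/
def IsCycleWord {N : ℕ} (R : ℤ) (B : Finset ℤ) (l : Fin N → ℤ) (c : ℝ)
    (β : List (Fin N)) : Prop :=
  β ≠ [] ∧ gWord R l β c = c ∧
    (∀ γ : List (Fin N), γ <+: β → γ ≠ [] → γ ≠ β → gWord R l γ c ≠ c) ∧
    nuWord R B l β c ≠ 0

/-- `Ω_c^{(0)}`: the finite words that do not end in a cycle word for `c`. -/
def OmegaZero {N : ℕ} (R : ℤ) (B : Finset ℤ) (l : Fin N → ℤ) (c : ℝ) : Set (List (Fin N)) :=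
  {ω | ∀ β, IsCycleWord R B l c β → ¬ β <:+ ω}

/-- The frequency `l_{ω_1} + R l_{ω_2} + ⋯ + R^{n-1} l_{ω_n} + R^n c` of a word
`ω = ω_1 … ω_n`. -/
def freq {N : ℕ} (R : ℤ) (l : Fin N → ℤ) (c : ℝ) (ω : List (Fin N)) : ℝ :=
  ∑ k : Fin ω.length, (R : ℝ) ^ (k : ℕ) * (l (ω.get k) : ℝ) + (R : ℝ) ^ ω.length * c

/-! ### Existence and uniqueness of the invariant measure -/

lemma measurable_tau (R b : ℤ) : Measurable (tau R b) := by
  unfold tau; fun_prop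

/-- Prepend a digit to a sequence of digits. -/
def consSeq {B : Type*} (p : B × (ℕ → B)) : ℕ → B
  | 0 => p.1
  | n + 1 => p.2 n

lemma measurable_consSeq {B : Type*} [MeasurableSpace B] :
    Measurable (consSeq : B × (ℕ → B) → ℕ → B) := by
  rw [measurable_pi_iff]
  rintro (_ | n)
  · exact measurable_fst
  · exact (measurable_pi_apply n).comp measurable_snd

lemma map_consSeq {B : Type*} [MeasurableSpace B] (u : Measure B) [IsProbabilityMeasure u] :
    (u.prod (Measure.infinitePi fun _ : ℕ => u)).map consSeq =
      Measure.infinitePi fun _ : ℕ => u := by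
  classical
  refine Measure.eq_infinitePi (fun _ : ℕ => u) fun s t ht => ?_
  let t' : ℕ → Set B := fun i => if i ∈ s then t i else Set.univ
  have ht' : ∀ i, MeasurableSet (t' i) := fun i => by
    by_cases h : i ∈ s <;> simp [t', h, ht]
  obtain ⟨n, hn⟩ : ∃ n, s ⊆ Finset.range (n + 1) :=
    ⟨s.sup id, fun i hi => Finset.mem_range.2 (Nat.lt_succ_of_le (Finset.le_sup (f := id) hi))⟩
  have hpre : consSeq ⁻¹' (Set.pi s t) =
      t' 0 ×ˢ Set.pi (Finset.range n : Set ℕ) (fun i => t' (i + 1)) := by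
    ext p
    simp only [Set.mem_preimage, Set.mem_pi, Set.mem_prod, Finset.mem_coe, Finset.mem_range]
    constructor
    · intro h
      refine ⟨?_, fun i _ => ?_⟩
      · by_cases h0 : 0 ∈ s
        · simpa [t', h0, consSeq] using h 0 h0
        · simp [t', h0]
      · by_cases h0 : i + 1 ∈ s
        · simpa [t', h0, consSeq] using h (i + 1) h0
        · simp [t', h0]
    · rintro ⟨h1, h2⟩ (_ | i) hi
      · simpa [t', hi, consSeq] using h1
      · have := h2 i (by have := Finset.mem_range.1 (hn hi); omega)
        simpa [t', hi, consSeq] using this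
  rw [Measure.map_apply measurable_consSeq (MeasurableSet.pi s.countable_toSet fun i _ => ht i),
    hpre, Measure.prod_prod, Measure.infinitePi_pi _ (fun i _ => ht' _)]
  have h1 : ∏ i ∈ s, u (t i) = ∏ i ∈ Finset.range (n + 1), u (t' i) := by
    rw [← Finset.prod_subset hn]
    · exact Finset.prod_congr rfl fun i hi => by simp [t', hi]
    · intro i _ hi; simp [t', hi]
  rw [h1, Finset.prod_range_succ', mul_comm]

/-- The point `∑_{k ≥ 1} R^{-k} b_k` of the attractor with the digits `b_1, b_2, …`. -/
def digitSum (R : ℤ) (B : Finset ℤ) (ω : ℕ → B) : ℝ := ∑' k, ((ω k : ℤ) : ℝ) / (R : ℝ) ^ (k + 1)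

lemma digitSum_bound {R : ℤ} (hR : 1 < |R|) (B : Finset ℤ) :
    ∃ u : ℕ → ℝ, Summable u ∧
      ∀ k (ω : ℕ → B), ‖((ω k : ℤ) : ℝ) / (R : ℝ) ^ (k + 1)‖ ≤ u k := by
  have hR' : 1 < |(R : ℝ)| := by exact_mod_cast hR
  refine ⟨fun k => (∑ b ∈ B, |(b : ℝ)|) * (|(R : ℝ)|⁻¹) ^ (k + 1), ?_, fun k ω => ?_⟩
  · refine Summable.mul_left _ ?_
    exact (summable_nat_add_iff 1).2
      (summable_geometric_of_lt_one (by positivity) (inv_lt_one_of_one_lt₀ hR'))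
  · rw [norm_div, norm_pow, Real.norm_eq_abs, Real.norm_eq_abs, div_eq_mul_inv, ← inv_pow]
    refine mul_le_mul_of_nonneg_right ?_ (by positivity)
    exact Finset.single_le_sum (f := fun b : ℤ => |(b : ℝ)|) (fun _ _ => abs_nonneg _) (ω k).2

lemma measurable_digitSum {R : ℤ} (hR : 1 < |R|) (B : Finset ℤ) : Measurable (digitSum R B) := by
  obtain ⟨u, hu, hb⟩ := digitSum_bound hR B
  refine Continuous.measurable (continuous_tsum (fun k => ?_) hu hb)
  refine Continuous.div_const ?_ _
  exact (continuous_of_discreteTopology (f := fun b : B => ((b : ℤ) : ℝ))).comp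
    (continuous_apply k)

lemma digitSum_consSeq {R : ℤ} (hR : 1 < |R|) (B : Finset ℤ) (b : B) (ω : ℕ → B) :
    digitSum R B (consSeq (b, ω)) = tau R b (digitSum R B ω) := by
  obtain ⟨u, hu, hb⟩ := digitSum_bound hR B
  have hs : ∀ ω : ℕ → B, Summable fun k => ((ω k : ℤ) : ℝ) / (R : ℝ) ^ (k + 1) :=
    fun ω => Summable.of_norm_bounded hu fun k => hb k ω
  have hR0 : (R : ℝ) ≠ 0 := by
    rintro h
    have : R = 0 := by exact_mod_cast h
    simp [this] at hR
  unfold digitSum tau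
  rw [(hs _).tsum_eq_zero_add, add_div, add_comm, ← tsum_div_const]
  congr 1
  · refine tsum_congr fun k => ?_
    simp only [consSeq]
    rw [pow_succ _ (k + 1), div_div]
  · simp [consSeq]

lemma exists_isInvariantMeasure {R : ℤ} (hR : 1 < |R|) {B : Finset ℤ} (hB : B.Nonempty) :
    ∃ μ, IsInvariantMeasure R B μ := by
  have : Nonempty B := hB.to_subtype
  let u : Measure B := (PMF.uniformOfFintype B).toMeasure
  let P : Measure (ℕ → B) := Measure.infinitePi fun _ : ℕ => u
  have hX := measurable_digitSum hR B
  refine ⟨P.map (digitSum R B), Measure.isProbabilityMeasure_map hX.aemeasurable, ?_⟩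
  rintro f hf ⟨C, hC⟩
  have hm : ∀ b : ℤ, Measurable fun x => f (tau R b x) := fun b => hf.comp (measurable_tau R b)
  rw [integral_map hX.aemeasurable hf.aestronglyMeasurable]
  simp_rw [fun b : ℤ => integral_map (μ := P) hX.aemeasurable (hm b).aestronglyMeasurable]
  have hP : P = (u.prod P).map consSeq := (map_consSeq u).symm
  have hfX : Measurable fun ω => f (digitSum R B ω) := hf.comp hX
  calc ∫ ω, f (digitSum R B ω) ∂P
      = ∫ ω, f (digitSum R B ω) ∂((u.prod P).map consSeq) := by rw [← hP]
    _ = ∫ p, f (digitSum R B (consSeq p)) ∂(u.prod P) :=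
        integral_map measurable_consSeq.aemeasurable hfX.aestronglyMeasurable
    _ = ∫ b, ∫ ω, f (digitSum R B (consSeq (b, ω))) ∂P ∂u :=
        integral_prod _ (Integrable.of_bound
          (hfX.comp measurable_consSeq).aestronglyMeasurable C (.of_forall fun _ => hC _))
    _ = ∫ b : B, ∫ ω, f (tau R b (digitSum R B ω)) ∂P ∂u := by
        simp_rw [digitSum_consSeq hR]
    _ = (1 / (B.card : ℂ)) * ∑ b ∈ B, ∫ ω, f (tau R b (digitSum R B ω)) ∂P := by
        rw [PMF.integral_eq_sum, Finset.mul_sum,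
          ← Finset.sum_coe_sort B fun b => (1 / (B.card : ℂ)) *
            ∫ ω, f (tau R b (digitSum R B ω)) ∂P]
        refine Finset.sum_congr rfl fun b _ => ?_
        simp [PMF.uniformOfFintype_apply]

lemma IsInvariantMeasure.charFun_eq {R : ℤ} {B : Finset ℤ} {μ : Measure ℝ}
    (h : IsInvariantMeasure R B μ) (t : ℝ) :
    charFun μ t = (1 / (B.card : ℂ)) *
      ∑ b ∈ B, Complex.exp ((t / R * b : ℝ) * Complex.I) * charFun μ (t / R) := by
  rw [charFun_apply_real, h.integral_eq (fun x => Complex.exp (t * x * Complex.I))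
    (by fun_prop) ⟨1, fun x => by
      rw [← Complex.ofReal_mul, Complex.norm_exp_ofReal_mul_I]⟩]
  congr 1
  refine Finset.sum_congr rfl fun b _ => ?_
  rw [charFun_apply_real, ← integral_const_mul]
  refine integral_congr_ae (.of_forall fun x => ?_)
  simp only [tau]
  rw [← Complex.exp_add]
  congr 1
  push_cast
  ring

lemma IsInvariantMeasure.unique {R : ℤ} (hR : 1 < |R|) {B : Finset ℤ} (hB : B.Nonempty)
    {μ ν : Measure ℝ} (hμ : IsInvariantMeasure R B μ) (hν : IsInvariantMeasure R B ν) :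
    μ = ν := by
  have := hμ.isProbabilityMeasure
  have := hν.isProbabilityMeasure
  have hR' : 1 < |(R : ℝ)| := by exact_mod_cast hR
  have hN : (0 : ℝ) < B.card := by exact_mod_cast hB.card_pos
  refine Measure.ext_of_charFun (funext fun t => ?_)
  have step : ∀ t, ‖charFun μ t - charFun ν t‖ ≤ ‖charFun μ (t / R) - charFun ν (t / R)‖ := by
    intro t
    rw [hμ.charFun_eq t, hν.charFun_eq t, ← mul_sub, ← Finset.sum_sub_distrib, norm_mul]
    simp_rw [← mul_sub]
    have h1 : ‖∑ b ∈ B, Complex.exp ((t / R * b : ℝ) * Complex.I) *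
        (charFun μ (t / R) - charFun ν (t / R))‖ ≤
        B.card * ‖charFun μ (t / R) - charFun ν (t / R)‖ := by
      refine (norm_sum_le _ _).trans (le_of_eq ?_)
      simp only [norm_mul, Complex.norm_exp_ofReal_mul_I, one_mul, Finset.sum_const, nsmul_eq_mul]
    refine (mul_le_mul_of_nonneg_left h1 (norm_nonneg _)).trans (le_of_eq ?_)
    rw [norm_div, norm_one, Complex.norm_natCast]
    field_simp
  have iter : ∀ n : ℕ, ‖charFun μ t - charFun ν t‖ ≤
      ‖charFun μ (t * ((R : ℝ)⁻¹) ^ n) - charFun ν (t * ((R : ℝ)⁻¹) ^ n)‖ := by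
    intro n
    induction n with
    | zero => simp
    | succ n ih =>
      refine ih.trans ((step _).trans (le_of_eq ?_))
      rw [div_eq_mul_inv, mul_assoc, ← pow_succ]
  have hlim : Filter.Tendsto (fun n : ℕ => t * ((R : ℝ)⁻¹) ^ n) Filter.atTop (nhds 0) := by
    have h := (tendsto_pow_atTop_nhds_zero_of_abs_lt_one (r := (R : ℝ)⁻¹)
      (by rw [abs_inv]; exact inv_lt_one_of_one_lt₀ hR')).const_mul t
    simpa using h
  have hc : Continuous fun t => ‖charFun μ t - charFun ν t‖ := by fun_prop
  have h0 := ge_of_tendsto' ((hc.tendsto 0).comp hlim) iter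
  simp only [charFun_zero, probReal_univ, sub_self, norm_zero] at h0
  exact sub_eq_zero.1 (norm_le_zero_iff.1 h0)

theorem existsUnique_isInvariantMeasure {R : ℤ} (hR : 1 < |R|) {B : Finset ℤ}
    (hB : B.Nonempty) : ∃! μ, IsInvariantMeasure R B μ := by
  obtain ⟨μ, hμ⟩ := exists_isInvariantMeasure hR hB
  exact ⟨μ, hμ, fun ν hν => hν.unique hR hB hμ⟩

theorem isInvariantMeasure_invariantMeasure {R : ℤ} (hR : 1 < |R|) {B : Finset ℤ}
    (hB : B.Nonempty) : IsInvariantMeasure R B (invariantMeasure R B) :=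
  Classical.epsilon_spec (exists_isInvariantMeasure hR hB)

end

end FractalFourier

open FractalFourier

namespace FractalFourier

noncomputable section

open ComplexConjugate

/-! ### Exponentials -/

/-! The numbers `‖ν_i(t)‖²` sum to one (`sum_norm_nu_sq`), so `t ↦ g_i(t)` is a random walk; its
recurrent classes are the minimal invariant sets.

Any two points of such a set are joined by a possible path, so each point lies on a loop. The loop
gives the points a common denominator `R ^ n - 1`, prime to `R`. Two possible successors of one
point would then differ by an integer, which the Hadamard condition forbids (`nu_unique`). So the
unique possible transition has weight of modulus one, and equality in the triangle inequality places
every point in `unitLattice B` (`subset_unitLattice`). As the maps `g_i` contract towards a bounded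
interval, only finitely many such points exist.

Orthogonality: `μ̂(R t) = m_B(t) μ̂(t)` and lattice periodicity of `m_B` make frequencies `l_i + R
s` and `l_j + R t`, with `s`, `t` in the lattice, orthogonal when `i ≠ j`; for `i = j` the inner
product is that of `s` and `t` (`muHat_sub`). Peeling off digits, two frequencies fail to be
orthogonal only if one word is the other followed by a path between the base points
(`exists_append_of_muHat_ne_zero`). Such a path stays in one minimal set, hence is a loop, and a
nonempty loop ends in a cycle word, which `OmegaZero` excludes.

Completeness: let `D(t)` be the squared distance from `e_t` to the closed span `K` of the
exponentials whose frequencies are built on cycle points. It is real analytic, vanishes at the cycle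
points, and is at most its weighted mean over the successors `g_i(t)`. A maximum principle forces `D
= 0` (`eq_zero_of_subharmonic`), so `K` contains every exponential, and these are total in `L²`.
Changing base points within a minimal set and deleting final cycle words leaves the set of
frequencies intact. -/

lemma expFun_eq (t x : ℝ) : expFun t x = Complex.exp ((2 * Real.pi * (t * x) : ℝ) * Complex.I) := by
  unfold expFun; congr 1; push_cast; ring

lemma expFun_comm (t x : ℝ) : expFun t x = expFun x t := by
  rw [expFun_eq, expFun_eq, mul_comm t x]

@[simp] lemma norm_expFun (t x : ℝ) : ‖expFun t x‖ = 1 := by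
  rw [expFun_eq, Complex.norm_exp_ofReal_mul_I]

@[simp] lemma expFun_zero_left (x : ℝ) : expFun 0 x = 1 := by simp [expFun]

@[simp] lemma expFun_zero_right (t : ℝ) : expFun t 0 = 1 := by simp [expFun]

lemma expFun_add_left (s t x : ℝ) : expFun (s + t) x = expFun s x * expFun t x := by
  rw [expFun, expFun, expFun, ← Complex.exp_add]; congr 1; push_cast; ring

lemma expFun_add_right (t x y : ℝ) : expFun t (x + y) = expFun t x * expFun t y := by
  rw [expFun_comm, expFun_add_left, expFun_comm x, expFun_comm y]

lemma conj_expFun (t x : ℝ) : conj (expFun t x) = expFun (-t) x := by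
  rw [expFun_eq, expFun_eq, ← Complex.exp_conj, map_mul, Complex.conj_ofReal, Complex.conj_I]
  congr 1; push_cast; ring

lemma conj_expFun' (t x : ℝ) : conj (expFun t x) = expFun t (-x) := by
  rw [conj_expFun, expFun_eq, expFun_eq]; congr 1; push_cast; ring

@[fun_prop] lemma continuous_expFun (t : ℝ) : Continuous (expFun t) := by
  unfold expFun; fun_prop

lemma expFun_intCast_intCast (b k : ℤ) : expFun b k = 1 := by
  rw [expFun, Complex.exp_eq_one_iff]
  exact ⟨b * k, by push_cast; ring⟩

lemma expFun_eq_one_iff {t x : ℝ} : expFun t x = 1 ↔ ∃ k : ℤ, t * x = k := by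
  rw [expFun, Complex.exp_eq_one_iff]
  refine exists_congr fun k => ?_
  have hpi : (2 * Real.pi * Complex.I : ℂ) ≠ 0 := Complex.two_pi_I_ne_zero
  constructor
  · intro h
    have : (2 * Real.pi * Complex.I : ℂ) * (t * x) = (2 * Real.pi * Complex.I) * k := by
      rw [mul_comm _ (k : ℂ), ← h]; ring
    exact_mod_cast mul_left_cancel₀ hpi this
  · intro h
    have : (t : ℂ) * x = k := by exact_mod_cast h
    rw [mul_assoc, this]; ring

/-! ### The lattice of points at which every `e_b`, `b ∈ B`, equals one -/

/-- The points `t` with `b t ∈ ℤ` for all `b ∈ B`. -/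
def unitLattice (B : Finset ℤ) : Set ℝ := {t | ∀ b ∈ B, expFun b t = 1}

lemma mB_add_of_mem {B : Finset ℤ} {t : ℝ} (ht : t ∈ unitLattice B) (s : ℝ) :
    mB B (s + t) = mB B s := by
  unfold mB
  congr 1
  refine Finset.sum_congr rfl fun b hb => ?_
  rw [expFun_add_right, ht b hb, mul_one]

lemma intCast_mem_unitLattice (B : Finset ℤ) (k : ℤ) : (k : ℝ) ∈ unitLattice B :=
  fun b _ => expFun_intCast_intCast b k

lemma add_mem_unitLattice {B : Finset ℤ} {s t : ℝ} (hs : s ∈ unitLattice B)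
    (ht : t ∈ unitLattice B) : s + t ∈ unitLattice B := fun b hb => by
  rw [expFun_add_right, hs b hb, ht b hb, one_mul]

lemma neg_mem_unitLattice {B : Finset ℤ} {s : ℝ} (hs : s ∈ unitLattice B) :
    -s ∈ unitLattice B := fun b hb => by
  rw [← conj_expFun', hs b hb, map_one]

lemma sub_mem_unitLattice {B : Finset ℤ} {s t : ℝ} (hs : s ∈ unitLattice B)
    (ht : t ∈ unitLattice B) : s - t ∈ unitLattice B := by
  rw [sub_eq_add_neg]; exact add_mem_unitLattice hs (neg_mem_unitLattice ht)

lemma intCast_mul_mem_unitLattice {B : Finset ℤ} (k : ℤ) {t : ℝ} (ht : t ∈ unitLattice B) :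
    k * t ∈ unitLattice B := fun b hb => by
  obtain ⟨m, hm⟩ := expFun_eq_one_iff.1 (ht b hb)
  refine expFun_eq_one_iff.2 ⟨k * m, ?_⟩
  push_cast
  rw [← hm]; ring

lemma mB_zero {B : Finset ℤ} (hB : B.Nonempty) : mB B 0 = 1 := by
  have : (B.card : ℂ) ≠ 0 := by exact_mod_cast hB.card_pos.ne'
  simp [mB, this]

lemma mB_of_mem {B : Finset ℤ} (hB : B.Nonempty) {t : ℝ} (ht : t ∈ unitLattice B) :
    mB B t = 1 := by
  rw [← zero_add t, mB_add_of_mem ht, mB_zero hB]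

/-- An average of unit complex numbers has modulus one only if all of them agree, and the term of `0
∈ B` is `1`. -/
lemma mem_unitLattice_of_norm_mB_eq_one {B : Finset ℤ} (hB : (0 : ℤ) ∈ B) {t : ℝ}
    (ht : ‖mB B t‖ = 1) : t ∈ unitLattice B := by
  have hN : (0 : ℝ) < B.card := by exact_mod_cast Finset.card_pos.2 ⟨0, hB⟩
  set u := mB B t with hu
  have hu1 : conj u * u = 1 := by
    rw [Complex.conj_mul', ht]; simp
  have hle : ∀ b ∈ B, (conj u * expFun b t).re ≤ 1 := fun b _ => by
    refine (Complex.re_le_norm _).trans ?_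
    simp [ht]
  have hsum : ∑ b ∈ B, (conj u * expFun b t).re = ∑ b ∈ B, (1 : ℝ) := by
    have h1 : ∑ b ∈ B, conj u * expFun b t = B.card := by
      rw [← Finset.mul_sum]
      have h2 : ∑ b ∈ B, expFun b t = B.card * u := by
        have : (B.card : ℂ) ≠ 0 := by exact_mod_cast hN.ne'
        rw [hu, mB]; field_simp
      rw [h2, mul_left_comm, hu1, mul_one]
    rw [← Complex.re_sum, h1]; simp
  have heq := (Finset.sum_eq_sum_iff_of_le hle).1 hsum
  have hz : ∀ b ∈ B, expFun b t = u := by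
    intro b hb
    have h1 : conj u * expFun b t = 1 := by
      have hn : ‖conj u * expFun b t‖ = 1 := by simp [ht]
      have hr := heq b hb
      have h3 := Complex.sq_norm_sub_sq_re (conj u * expFun b t)
      rw [hn, hr] at h3
      apply Complex.ext
      · simpa using hr
      · have : (conj u * expFun b t).im ^ 2 = 0 := by linarith
        simpa using pow_eq_zero_iff (two_ne_zero) |>.1 this
    calc expFun b t = (u * conj u) * expFun b t := by rw [mul_comm u, hu1, one_mul]
      _ = u := by rw [mul_assoc, h1, mul_one]
  intro b hb
  rw [hz b hb, ← hz 0 hB]; simp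

/-! ### Hadamard systems -/

/-- The arithmetic consequences of unitarity of the Hadamard matrix. -/
structure IsHadamardSystem {N : ℕ} (R : ℤ) (B : Finset ℤ) (l : Fin N → ℤ) : Prop where
  one_lt_abs : 1 < |R|
  zero_mem : (0 : ℤ) ∈ B
  card_eq : B.card = N
  exists_eq_zero : ∃ i, l i = 0
  mB_eq : ∀ i j, mB B (((l i : ℝ) - l j) / R) = if i = j then 1 else 0
  sum_eq : ∀ a ∈ B, ∀ b ∈ B,
    ∑ i, expFun a (l i / R) * expFun b (-(l i / R)) = if a = b then (N : ℂ) else 0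

lemma hadamardMatrix_apply {N : ℕ} (R : ℤ) (B : Finset ℤ) (l : Fin N → ℤ) (i : Fin N) (b : B) :
    hadamardMatrix R B l i b = (1 / (Real.sqrt N : ℂ)) * expFun (b : ℤ) (l i / R) := by
  unfold hadamardMatrix expFun
  congr 2
  push_cast
  ring

/-- Row orthogonality `U U* = 1` becomes `mB_eq`, the source of orthogonal frequencies; column
orthogonality `U* U = 1` becomes `sum_eq`, the source of the total weight one. -/
lemma isHadamardSystem {N : ℕ} [NeZero N] (R : ℤ) (hR : 1 < |R|)
    (B : Finset ℤ) (hB0 : (0 : ℤ) ∈ B) (hBN : B.card = N)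
    (l : Fin N → ℤ) (hl0 : l 0 = 0)
    (hU : hadamardMatrix R B l * (hadamardMatrix R B l).conjTranspose = 1 ∧
      (hadamardMatrix R B l).conjTranspose * hadamardMatrix R B l = 1) :
    IsHadamardSystem R B l := by
  have hN : (N : ℂ) ≠ 0 := by exact_mod_cast NeZero.ne N
  have hsq : (1 / (Real.sqrt N : ℂ)) * (1 / (Real.sqrt N : ℂ)) = 1 / N := by
    rw [div_mul_div_comm, one_mul, ← Complex.ofReal_mul, Real.mul_self_sqrt (Nat.cast_nonneg N)]
    simp
  have hcs : conj (1 / (Real.sqrt N : ℂ)) = 1 / (Real.sqrt N : ℂ) := by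
    simp
  refine ⟨hR, hB0, hBN, ⟨0, hl0⟩, fun i j => ?_, fun a ha b hb => ?_⟩
  · have h := congrFun (congrFun hU.1 i) j
    rw [Matrix.mul_apply, Matrix.one_apply] at h
    rw [← h, mB, hBN, ← Finset.sum_coe_sort B, Finset.mul_sum]
    refine Finset.sum_congr rfl fun b _ => ?_
    rw [Matrix.conjTranspose_apply, hadamardMatrix_apply, hadamardMatrix_apply]
    rw [← starRingEnd_apply, map_mul, hcs, conj_expFun', mul_mul_mul_comm, hsq,
      ← expFun_add_right]
    congr 2; ring
  · have h := congrFun (congrFun hU.2 ⟨b, hb⟩) ⟨a, ha⟩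
    rw [Matrix.mul_apply, Matrix.one_apply] at h
    have h2 : ∑ i, expFun a (l i / R) * expFun b (-(l i / R)) =
        N * ∑ i, (hadamardMatrix R B l).conjTranspose ⟨b, hb⟩ i * hadamardMatrix R B l i ⟨a, ha⟩ := by
      rw [Finset.mul_sum]
      refine Finset.sum_congr rfl fun i _ => ?_
      rw [Matrix.conjTranspose_apply, hadamardMatrix_apply, hadamardMatrix_apply,
        ← starRingEnd_apply, map_mul, hcs, conj_expFun', mul_mul_mul_comm, hsq]
      field_simp
    rw [h2, h]
    by_cases hab : a = b
    · subst hab; simp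
    · have : b ≠ a := fun h => hab h.symm
      simp [hab, this]

namespace IsHadamardSystem

variable {N : ℕ} {R : ℤ} {B : Finset ℤ} {l : Fin N → ℤ}

lemma nonempty (h : IsHadamardSystem R B l) : B.Nonempty := ⟨0, h.zero_mem⟩

lemma N_ne_zero (h : IsHadamardSystem R B l) : (N : ℂ) ≠ 0 := by
  rw [← h.card_eq]; exact_mod_cast h.nonempty.card_pos.ne'

lemma R_ne_zero (h : IsHadamardSystem R B l) : (R : ℝ) ≠ 0 := by
  have := h.one_lt_abs
  rintro h0
  have : R = 0 := by exact_mod_cast h0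
  simp_all

lemma two_le_abs (h : IsHadamardSystem R B l) : (2 : ℝ) ≤ |(R : ℝ)| := by
  have := h.one_lt_abs
  have h2 : 2 ≤ |R| := by omega
  exact_mod_cast h2

lemma nu_eq (h : IsHadamardSystem R B l) (i : Fin N) (t : ℝ) :
    nu R B l i t = (1 / (N : ℂ)) * ∑ b ∈ B, expFun b (t / R) * expFun b (-(l i / R)) := by
  unfold nu mB g
  rw [h.card_eq]
  congr 1
  refine Finset.sum_congr rfl fun b _ => ?_
  rw [← expFun_add_right]; congr 1; ring

/-- Polarised form of "the weights sum to one". The off-diagonal pairs `a ≠ b` cancel by column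
orthogonality. It is used with `s ≠ t` to compute inner products of exponentials. -/
lemma sum_conj_nu_mul_nu (h : IsHadamardSystem R B l) (s t : ℝ) :
    ∑ i, conj (nu R B l i s) * nu R B l i t = mB B ((t - s) / R) := by
  have hN := h.N_ne_zero
  simp_rw [h.nu_eq, map_mul, map_sum, map_mul, conj_expFun']
  have h1 : ∀ i, conj (1 / (N : ℂ)) * (∑ a ∈ B, expFun a (-(s / R)) * expFun a (- -(l i / R))) *
      (1 / (N : ℂ) * ∑ b ∈ B, expFun b (t / R) * expFun b (-(l i / R))) =
      ∑ a ∈ B, ∑ b ∈ B, (1 / (N : ℂ) * (1 / N)) * (expFun a (-(s / R)) * expFun b (t / R)) *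
        (expFun a (l i / R) * expFun b (-(l i / R))) := by
    intro i
    rw [mul_mul_mul_comm, Finset.sum_mul_sum, Finset.mul_sum]
    refine Finset.sum_congr rfl fun a _ => ?_
    rw [Finset.mul_sum]
    refine Finset.sum_congr rfl fun b _ => ?_
    simp only [map_div₀, map_one, Complex.conj_natCast, neg_neg]
    ring
  simp_rw [h1]
  rw [Finset.sum_comm]
  unfold mB
  rw [Finset.mul_sum]
  refine Finset.sum_congr rfl fun a ha => ?_
  rw [Finset.sum_comm]
  simp_rw [← Finset.mul_sum]
  rw [Finset.sum_congr rfl fun b hb => by rw [h.sum_eq a ha b hb]]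
  simp only [mul_ite, mul_zero, Finset.sum_ite_eq, ha, if_true]
  rw [← expFun_add_right, h.card_eq]
  have : -(s / R) + t / R = (t - s) / (R : ℝ) := by ring
  rw [this]
  field_simp

lemma sum_norm_nu_sq (h : IsHadamardSystem R B l) (t : ℝ) :
    ∑ i, ‖nu R B l i t‖ ^ 2 = 1 := by
  have h1 := h.sum_conj_nu_mul_nu t t
  simp only [sub_self, zero_div, mB_zero h.nonempty, Complex.conj_mul'] at h1
  exact_mod_cast h1

lemma exists_nu_ne_zero (h : IsHadamardSystem R B l) (t : ℝ) : ∃ i, nu R B l i t ≠ 0 := by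
  by_contra! hc
  have := h.sum_norm_nu_sq t
  simp [hc] at this

lemma eq_of_mem_unitLattice (h : IsHadamardSystem R B l) {i j : Fin N}
    (hij : ((l i : ℝ) - l j) / R ∈ unitLattice B) : i = j := by
  by_contra hne
  have h1 := h.mB_eq i j
  rw [mB_of_mem h.nonempty hij, if_neg hne] at h1
  exact one_ne_zero h1

end IsHadamardSystem

/-- The Fourier transform of the invariant measure. -/
def muHat (R : ℤ) (B : Finset ℤ) (t : ℝ) : ℂ := ∫ x, expFun t x ∂(invariantMeasure R B)

/-! ### The refinement equation for the Fourier transform -/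

namespace IsHadamardSystem

variable {N : ℕ} {R : ℤ} {B : Finset ℤ} {l : Fin N → ℤ}

lemma isInvariantMeasure (h : IsHadamardSystem R B l) :
    IsInvariantMeasure R B (invariantMeasure R B) :=
  isInvariantMeasure_invariantMeasure h.one_lt_abs h.nonempty

lemma isProbabilityMeasure (h : IsHadamardSystem R B l) :
    IsProbabilityMeasure (invariantMeasure R B) := h.isInvariantMeasure.isProbabilityMeasure

lemma muHat_zero (h : IsHadamardSystem R B l) : muHat R B 0 = 1 := by
  have := h.isProbabilityMeasure
  simp [muHat]

lemma muHat_eq (h : IsHadamardSystem R B l) (t : ℝ) :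
    muHat R B t = mB B (t / R) * muHat R B (t / R) := by
  unfold muHat
  rw [h.isInvariantMeasure.integral_eq (expFun t) (continuous_expFun t).measurable
    ⟨1, fun x => (norm_expFun t x).le⟩, mB, mul_assoc, Finset.sum_mul]
  congr 1
  refine Finset.sum_congr rfl fun b _ => ?_
  rw [← integral_const_mul]
  congr 1
  ext x
  rw [expFun_comm b, ← expFun_add_right, tau, expFun_eq, expFun_eq]
  congr 3
  ring

lemma muHat_mul (h : IsHadamardSystem R B l) (t : ℝ) :
    muHat R B (R * t) = mB B t * muHat R B t := by
  rw [h.muHat_eq, mul_div_cancel_left₀ _ h.R_ne_zero]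

/-- Exponentials obtained by prepending digits to frequencies in the lattice. -/
lemma muHat_sub (h : IsHadamardSystem R B l) {s t : ℝ} (hs : s ∈ unitLattice B)
    (ht : t ∈ unitLattice B) (i j : Fin N) :
    muHat R B ((l j + R * t) - (l i + R * s)) = if j = i then muHat R B (t - s) else 0 := by
  have h1 : (l j + R * t) - (l i + R * s) = (R : ℝ) * (((l j : ℝ) - l i) / R + (t - s)) := by
    have := h.R_ne_zero
    field_simp
    ring
  -- The lattice part `t - s` drops out of `m_B`, leaving the Hadamard value at `(l j - l i) / R`.
  rw [h1, h.muHat_mul, mB_add_of_mem (sub_mem_unitLattice ht hs), h.mB_eq]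
  split_ifs with hij
  · subst hij; simp
  · simp

end IsHadamardSystem

lemma muHat_neg (R : ℤ) (B : Finset ℤ) (t : ℝ) : muHat R B (-t) = conj (muHat R B t) := by
  unfold muHat
  rw [← integral_conj]
  simp_rw [conj_expFun]

/-! ### Words and frequencies -/

section Words

variable {N : ℕ} {R : ℤ} {B : Finset ℤ} {l : Fin N → ℤ}

lemma gWord_append (ω γ : List (Fin N)) (t : ℝ) :
    gWord R l (ω ++ γ) t = gWord R l γ (gWord R l ω t) := by
  induction ω generalizing t with
  | nil => rfl
  | cons i ω ih => exact ih _

lemma nuWord_append (ω γ : List (Fin N)) (t : ℝ) :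
    nuWord R B l (ω ++ γ) t = nuWord R B l ω t * nuWord R B l γ (gWord R l ω t) := by
  induction ω generalizing t with
  | nil => simp [nuWord, gWord]
  | cons i ω ih => simp [nuWord, gWord, ih, mul_assoc]

@[simp] lemma freq_nil (c : ℝ) : freq R l c [] = c := by simp [freq]

lemma freq_cons (c : ℝ) (i : Fin N) (ω : List (Fin N)) :
    freq R l c (i :: ω) = l i + R * freq R l c ω := by
  unfold freq
  simp only [List.length_cons, Fin.sum_univ_succ, List.get_eq_getElem, Fin.val_zero, pow_zero,
    one_mul, Fin.val_succ, List.getElem_cons_zero, List.getElem_cons_succ, mul_add, Finset.mul_sum,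
    pow_succ]
  rw [add_assoc]
  congr 2
  · exact Finset.sum_congr rfl fun _ _ => by ring
  · ring

lemma freq_append (c : ℝ) (ω γ : List (Fin N)) :
    freq R l c (ω ++ γ) = freq R l (freq R l c γ) ω := by
  induction ω with
  | nil => simp
  | cons i ω ih => simp [freq_cons, ih]

lemma mul_g (hR : (R : ℝ) ≠ 0) (i : Fin N) (t : ℝ) : l i + R * g R l i t = t := by
  unfold g; field_simp; ring

lemma freq_gWord (hR : (R : ℝ) ≠ 0) (ω : List (Fin N)) (t : ℝ) :
    freq R l (gWord R l ω t) ω = t := by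
  induction ω generalizing t with
  | nil => simp [gWord]
  | cons i ω ih => rw [freq_cons, gWord, ih, mul_g hR]

lemma exists_freq_eq (c : ℝ) (ω : List (Fin N)) :
    ∃ k : ℤ, freq R l c ω = k + (R : ℝ) ^ ω.length * c := by
  induction ω with
  | nil => exact ⟨0, by simp⟩
  | cons i ω ih =>
    obtain ⟨k, hk⟩ := ih
    refine ⟨l i + R * k, ?_⟩
    rw [freq_cons, hk, List.length_cons, pow_succ]
    push_cast
    ring

lemma IsInvariant.gWord_mem {M : Set ℝ} (hM : IsInvariant R B l M) {t : ℝ} (ht : t ∈ M)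
    {ω : List (Fin N)} (hω : nuWord R B l ω t ≠ 0) : gWord R l ω t ∈ M := by
  induction ω generalizing t with
  | nil => exact ht
  | cons i ω ih =>
    rw [nuWord] at hω
    exact ih (hM t ht i (left_ne_zero_of_mul hω)) (right_ne_zero_of_mul hω)

lemma isInvariant_orbit (t : ℝ) :
    IsInvariant R B l {s | ∃ ω, nuWord R B l ω t ≠ 0 ∧ gWord R l ω t = s} := by
  rintro s ⟨ω, hω, rfl⟩ i hi
  refine ⟨ω ++ [i], ?_, by simp [gWord_append, gWord]⟩
  rw [nuWord_append]
  simpa [nuWord] using ⟨hω, hi⟩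

/-- A possible loop at `c` ends in a cycle word. -/
lemma exists_isCycleWord_suffix {c : ℝ} {ω : List (Fin N)} (hne : ω ≠ [])
    (hg : gWord R l ω c = c) (hν : nuWord R B l ω c ≠ 0) :
    ∃ β, IsCycleWord R B l c β ∧ β <:+ ω := by
  induction h : ω.length using Nat.strong_induction_on generalizing ω with
  | _ n ih =>
    by_cases hprim : ∀ γ : List (Fin N), γ <+: ω → γ ≠ [] → γ ≠ ω → gWord R l γ c ≠ c
    · exact ⟨ω, ⟨hne, hg, hprim, hν⟩, List.suffix_rfl⟩
    · push Not at hprim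
      obtain ⟨γ, ⟨δ, rfl⟩, hγ0, hγω, hγ⟩ := hprim
      have hδ : δ ≠ [] := by rintro rfl; simp at hγω
      -- Deleting the initial loop `γ` leaves the shorter possible loop `δ` at `c`.
      rw [gWord_append, hγ] at hg
      rw [nuWord_append, hγ] at hν
      have hlen : δ.length < n := by
        have := List.length_pos_iff.2 hγ0
        rw [← h, List.length_append]; omega
      obtain ⟨β, hβ, hs⟩ := ih _ hlen hδ hg (right_ne_zero_of_mul hν) rfl
      exact ⟨β, hβ, hs.trans (List.suffix_append _ _)⟩

/-- Removing cycle words from the end of a word does not change its frequency. -/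
lemma exists_mem_OmegaZero (hR : (R : ℝ) ≠ 0) (c : ℝ) (ω : List (Fin N)) :
    ∃ γ ∈ OmegaZero R B l c, freq R l c γ = freq R l c ω := by
  induction h : ω.length using Nat.strong_induction_on generalizing ω with
  | _ n ih =>
    by_cases hω : ω ∈ OmegaZero R B l c
    · exact ⟨ω, hω, rfl⟩
    · simp only [OmegaZero, Set.mem_ofPred_eq, not_forall, not_not] at hω
      obtain ⟨β, hβ, ⟨δ, rfl⟩⟩ := hω
      have hlen : δ.length < n := by
        have := List.length_pos_iff.2 hβ.1
        rw [← h, List.length_append]; omega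
      obtain ⟨γ, hγ, hfr⟩ := ih _ hlen δ rfl
      refine ⟨γ, hγ, ?_⟩
      have hβc : freq R l c β = c := by
        conv_lhs => rw [← hβ.2.1]
        exact freq_gWord hR β c
      rw [hfr, freq_append, hβc]

end Words

/-! ### Minimal invariant sets -/

namespace IsMinimalInvariant

variable {N : ℕ} {R : ℤ} {B : Finset ℤ} {l : Fin N → ℤ} {M : Set ℝ}

lemma isInvariant (hM : IsMinimalInvariant R B l M) : IsInvariant R B l M := hM.prop.2

/-- The orbit of `s` is a nonempty invariant subset of `M`, so by minimality it is all of `M`. -/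
lemma exists_word (hM : IsMinimalInvariant R B l M) {s t : ℝ} (hs : s ∈ M) (ht : t ∈ M) :
    ∃ ω, nuWord R B l ω s ≠ 0 ∧ gWord R l ω s = t := by
  refine hM.le_of_le (y := {s' | ∃ ω, nuWord R B l ω s ≠ 0 ∧ gWord R l ω s = s'})
    ⟨⟨s, [], by simp [nuWord], rfl⟩, isInvariant_orbit s⟩ ?_ ht
  rintro _ ⟨ω, hω, rfl⟩
  exact hM.isInvariant.gWord_mem hs hω

lemma eq_of_mem {M' : Set ℝ} (hM : IsMinimalInvariant R B l M)
    (hM' : IsMinimalInvariant R B l M') {t : ℝ} (ht : t ∈ M) (ht' : t ∈ M') : M = M' := by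
  have hI : (M ∩ M').Nonempty ∧ IsInvariant R B l (M ∩ M') :=
    ⟨⟨t, ht, ht'⟩, fun s hs i hi => ⟨hM.isInvariant s hs.1 i hi, hM'.isInvariant s hs.2 i hi⟩⟩
  refine Set.Subset.antisymm ?_ ?_
  · exact (hM.le_of_le hI Set.inter_subset_left).trans Set.inter_subset_right
  · exact (hM'.le_of_le hI Set.inter_subset_right).trans Set.inter_subset_left

lemma exists_loop (hM : IsMinimalInvariant R B l M) (h : IsHadamardSystem R B l) {t : ℝ}
    (ht : t ∈ M) : ∃ ω, ω ≠ [] ∧ nuWord R B l ω t ≠ 0 ∧ gWord R l ω t = t := by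
  obtain ⟨i, hi⟩ := h.exists_nu_ne_zero t
  obtain ⟨ω, hω, hg⟩ := hM.exists_word (hM.isInvariant t ht i hi) ht
  exact ⟨i :: ω, by simp, by rw [nuWord]; exact mul_ne_zero hi hω, hg⟩

/-- All points of a minimal invariant set have a common denominator that is prime to `R`. -/
lemma exists_denominator (hM : IsMinimalInvariant R B l M) (h : IsHadamardSystem R B l) :
    ∃ n : ℕ, n ≠ 0 ∧ ∀ s ∈ M, ∃ k : ℤ, ((R : ℝ) ^ n - 1) * s = k := by
  obtain ⟨t, ht⟩ := hM.prop.1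
  obtain ⟨ω, hne, -, hg⟩ := hM.exists_loop h ht
  have hfr := freq_gWord h.R_ne_zero ω t (l := l)
  obtain ⟨k, hk⟩ := exists_freq_eq t ω (R := R) (l := l)
  rw [hg] at hfr
  -- Reading the loop backwards gives `t = k + R ^ n * t` with `n` its length.
  have htk : ((R : ℝ) ^ ω.length - 1) * t = (-k : ℤ) := by
    push_cast; linarith
  refine ⟨ω.length, by simpa using hne, fun s hs => ?_⟩
  obtain ⟨γ, -, hγ⟩ := hM.exists_word hs ht
  have hfs := freq_gWord h.R_ne_zero γ s (l := l)
  obtain ⟨m, hm⟩ := exists_freq_eq t γ (R := R) (l := l)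
  rw [hγ, hm] at hfs
  refine ⟨(R ^ ω.length - 1) * m + R ^ γ.length * (-k), ?_⟩
  rw [← hfs]
  push_cast at htk ⊢
  linear_combination (R : ℝ) ^ γ.length * htk

/-- Let `d = (l i - l j) / R` be the difference of the two successors. Both `R * d` and `(R ^ n - 1)
* d` are integers, hence so is `d`; then `m_B(d) = 1`, which forces `i = j`. -/
lemma nu_unique (hM : IsMinimalInvariant R B l M) (h : IsHadamardSystem R B l) {t : ℝ}
    (ht : t ∈ M) {i j : Fin N} (hi : nu R B l i t ≠ 0) (hj : nu R B l j t ≠ 0) : i = j := by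
  obtain ⟨n, hn, hden⟩ := hM.exists_denominator h
  obtain ⟨k, hk⟩ := hden _ (hM.isInvariant t ht i hi)
  obtain ⟨m, hm⟩ := hden _ (hM.isInvariant t ht j hj)
  refine h.eq_of_mem_unitLattice ?_
  have hR := h.R_ne_zero
  obtain ⟨p, rfl⟩ := Nat.exists_eq_succ_of_ne_zero hn
  have : ((l i : ℝ) - l j) / R = ((R ^ p * (l i - l j) + k - m : ℤ) : ℝ) := by
    have h1 : ((l i : ℝ) - l j) / R = g R l j t - g R l i t := by unfold g; field_simp; ring
    have h2 : (l i : ℝ) - l j = R * (g R l j t - g R l i t) := by rw [← h1]; field_simp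
    push_cast
    rw [h1, h2, ← hk, ← hm, Nat.succ_eq_add_one, pow_succ]
    ring
  rw [this]
  exact intCast_mem_unitLattice B _

/-- The last step of a loop at `s` comes from a point of `M` whose only possible transition leads to
`s`. Its weight `m_B(s)` therefore has modulus one. -/
lemma subset_unitLattice (hM : IsMinimalInvariant R B l M) (h : IsHadamardSystem R B l) :
    M ⊆ unitLattice B := by
  intro s hs
  obtain ⟨ω, hne, hν, hg⟩ := hM.exists_loop h hs
  obtain ⟨γ, i, rfl⟩ : ∃ γ i, ω = γ ++ [i] :=
    ⟨ω.dropLast, ω.getLast hne, (List.dropLast_append_getLast hne).symm⟩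
  rw [nuWord_append] at hν
  have ht := hM.isInvariant.gWord_mem hs (left_ne_zero_of_mul hν)
  have hi : nu R B l i (gWord R l γ s) ≠ 0 := by
    have := right_ne_zero_of_mul hν
    simpa [nuWord] using this
  have hs' : g R l i (gWord R l γ s) = s := by
    simpa [gWord_append, gWord] using hg
  refine mem_unitLattice_of_norm_mB_eq_one h.zero_mem ?_
  have hsum := h.sum_norm_nu_sq (gWord R l γ s)
  rw [Finset.sum_eq_single i] at hsum
  · rw [nu, hs'] at hsum
    exact (pow_eq_one_iff_of_nonneg (norm_nonneg _) two_ne_zero).1 hsum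
  · intro j _ hj
    by_contra hjn
    exact hj (hM.nu_unique h ht (fun h0 => hjn (by simp [h0])) hi)
  · simp

end IsMinimalInvariant

/-- The union of all minimal invariant sets. -/
def cyclePoints {N : ℕ} (R : ℤ) (B : Finset ℤ) (l : Fin N → ℤ) : Set ℝ :=
  {t | ∃ M, IsMinimalInvariant R B l M ∧ t ∈ M}

/-! ### Boundedness and finiteness of the cycle points -/

namespace IsHadamardSystem

variable {N : ℕ} {R : ℤ} {B : Finset ℤ} {l : Fin N → ℤ}

lemma abs_g_le (h : IsHadamardSystem R B l) (i : Fin N) (t : ℝ) :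
    |g R l i t| ≤ (|t| + ∑ j, |(l j : ℝ)|) / 2 := by
  unfold g
  rw [abs_div]
  have h1 : |t - l i| ≤ |t| + ∑ j, |(l j : ℝ)| :=
    (abs_sub _ _).trans (add_le_add le_rfl
      (Finset.single_le_sum (f := fun j => |(l j : ℝ)|) (fun _ _ => abs_nonneg _)
        (Finset.mem_univ i)))
  exact div_le_div₀ ((abs_nonneg _).trans h1) h1 two_pos h.two_le_abs

lemma abs_gWord_le (h : IsHadamardSystem R B l) (ω : List (Fin N)) (t : ℝ) :
    |gWord R l ω t| ≤ ∑ j, |(l j : ℝ)| + (|t| - ∑ j, |(l j : ℝ)|) / 2 ^ ω.length := by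
  induction ω generalizing t with
  | nil => simp [gWord]
  | cons i ω ih =>
    refine (ih _).trans ?_
    rw [List.length_cons, pow_succ', ← div_div]
    have := h.abs_g_le i t
    gcongr
    linarith

lemma abs_le_of_mem_cyclePoints (h : IsHadamardSystem R B l) {t : ℝ}
    (ht : t ∈ cyclePoints R B l) : |t| ≤ ∑ j, |(l j : ℝ)| := by
  obtain ⟨M, hM, htM⟩ := ht
  obtain ⟨ω, hne, -, hg⟩ := hM.exists_loop h htM
  have hb := h.abs_gWord_le ω t
  rw [hg] at hb
  by_contra! hlt
  have h2 : (1 : ℝ) < 2 ^ ω.length := one_lt_pow₀ one_lt_two (by simpa using hne)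
  have h3 := div_lt_self (sub_pos.2 hlt) h2
  linarith

lemma cyclePoints_subset (h : IsHadamardSystem R B l) : cyclePoints R B l ⊆ unitLattice B := by
  rintro t ⟨M, hM, ht⟩
  exact hM.subset_unitLattice h ht

lemma finite_cyclePoints (h : IsHadamardSystem R B l) : (cyclePoints R B l).Finite := by
  set L := ∑ j, |(l j : ℝ)| with hL
  by_cases hb : ∃ b ∈ B, b ≠ 0
  · obtain ⟨b, hb, hb0⟩ := hb
    have hb0' : (b : ℝ) ≠ 0 := by exact_mod_cast hb0
    have hfin : ((fun k : ℤ => (k : ℝ) / b) '' Set.Icc (-⌈|(b : ℝ)| * L⌉) ⌈|(b : ℝ)| * L⌉).Finite :=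
      (Set.finite_Icc _ _).image _
    refine hfin.subset fun t ht => ?_
    obtain ⟨k, hk⟩ := expFun_eq_one_iff.1 (h.cyclePoints_subset ht b hb)
    refine ⟨k, ?_, by simp only; rw [← hk]; field_simp⟩
    have hkL : |(k : ℝ)| ≤ |(b : ℝ)| * L := by
      rw [← hk, abs_mul]
      exact mul_le_mul_of_nonneg_left (h.abs_le_of_mem_cyclePoints ht) (abs_nonneg _)
    have h1 : |k| ≤ ⌈|(b : ℝ)| * L⌉ := by
      have : ((|k| : ℤ) : ℝ) ≤ ⌈|(b : ℝ)| * L⌉ := by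
        push_cast; exact hkL.trans (Int.le_ceil _)
      exact_mod_cast this
    exact abs_le.1 h1
  -- If `B = {0}` the lattice is all of `ℝ`, but then `N = 1` and the bound on cycle points is `0`.
  · push Not at hb
    have hB : B = {0} := Finset.eq_singleton_iff_unique_mem.2 ⟨h.zero_mem, hb⟩
    have hN : N = 1 := by rw [← h.card_eq, hB, Finset.card_singleton]
    obtain ⟨i, hi⟩ := h.exists_eq_zero
    have hall : ∀ j, l j = 0 := fun j => by
      subst hN; rw [Subsingleton.elim j i, hi]
    refine (Set.finite_singleton (0 : ℝ)).subset fun t ht => ?_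
    have := h.abs_le_of_mem_cyclePoints ht
    simpa [hall] using this

lemma finite_minimalInvariant (h : IsHadamardSystem R B l) :
    {M : Set ℝ | IsMinimalInvariant R B l M}.Finite :=
  h.finite_cyclePoints.finite_subsets.subset fun M hM _ ht => ⟨M, hM, ht⟩

lemma exists_isMinimalInvariant_subset {Z : Set ℝ} (hfin : Z.Finite) (hne : Z.Nonempty)
    (hZ : IsInvariant R B l Z) : ∃ M ⊆ Z, IsMinimalInvariant R B l M := by
  have hsub : {M | M ⊆ Z ∧ M.Nonempty ∧ IsInvariant R B l M}.Finite :=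
    hfin.finite_subsets.subset fun M hM => hM.1
  obtain ⟨M, hMZ, hM⟩ := hsub.exists_le_minimal (a := Z) ⟨le_rfl, hne, hZ⟩
  refine ⟨M, hMZ, hM.prop.2, fun M' hM' hle => ?_⟩
  exact hM.le_of_le ⟨hle.trans hMZ, hM'⟩ hle

lemma zero_mem_cyclePoints (h : IsHadamardSystem R B l) : (0 : ℝ) ∈ cyclePoints R B l := by
  obtain ⟨i, hi⟩ := h.exists_eq_zero
  have hgi : g R l i 0 = 0 := by simp [g, hi]
  have hinv : IsInvariant R B l {0} := by
    rintro t rfl j hj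
    have hji : j = i := by
      by_contra hne
      have h1 := h.sum_norm_nu_sq 0
      have h2 : ‖nu R B l i 0‖ = 1 := by simp [nu, hgi, mB_zero h.nonempty]
      have h3 := Finset.add_le_sum (f := fun k => ‖nu R B l k 0‖ ^ 2) (s := Finset.univ)
        (fun _ _ => by positivity) (Finset.mem_univ i) (Finset.mem_univ j) (Ne.symm hne)
      have h4 : 0 < ‖nu R B l j 0‖ := norm_pos_iff.2 hj
      simp only [h1, h2] at h3
      nlinarith
    rw [hji, hgi]; rfl
  refine ⟨{0}, ⟨⟨⟨0, rfl⟩, hinv⟩, fun M' hM' hle => ?_⟩, rfl⟩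
  rcases Set.subset_singleton_iff_eq.1 hle with h0 | h0
  · exact absurd h0 hM'.1.ne_empty
  · exact h0.ge

/-! ### Orthogonality -/

lemma exists_successor (h : IsHadamardSystem R B l) {t : ℝ} (ht : t ∈ cyclePoints R B l) :
    ∃ i, nu R B l i t ≠ 0 ∧ g R l i t ∈ cyclePoints R B l := by
  obtain ⟨M, hM, htM⟩ := ht
  obtain ⟨i, hi⟩ := h.exists_nu_ne_zero t
  exact ⟨i, hi, M, hM, hM.isInvariant t htM i hi⟩

lemma freq_mem_unitLattice (c : ℝ) (hc : c ∈ unitLattice B) (ω : List (Fin N)) :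
    freq R l c ω ∈ unitLattice B := by
  induction ω with
  | nil => simpa
  | cons i ω ih =>
    rw [freq_cons]
    exact add_mem_unitLattice (intCast_mem_unitLattice B _) (intCast_mul_mem_unitLattice R ih)

/-- Following both points along their transitions, equal digits are forced at each step while the
difference is divided by `R`. A nonzero difference would thus take infinitely many values on a
finite set. -/
lemma eq_of_muHat_ne_zero (h : IsHadamardSystem R B l) {c d : ℝ} (hc : c ∈ cyclePoints R B l)
    (hd : d ∈ cyclePoints R B l) (hne : muHat R B (d - c) ≠ 0) : c = d := by
  by_contra hcd
  have hR := h.R_ne_zero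
  have hiter : ∀ n : ℕ, ∃ p ∈ cyclePoints R B l ×ˢ cyclePoints R B l,
      d - c = (R : ℝ) ^ n * (p.2 - p.1) ∧ muHat R B (p.2 - p.1) ≠ 0 := by
    intro n
    induction n with
    | zero => exact ⟨(c, d), ⟨hc, hd⟩, by simp, hne⟩
    | succ n ih =>
      obtain ⟨⟨p, q⟩, ⟨hp, hq⟩, heq, hm⟩ := ih
      obtain ⟨i, -, hgi⟩ := h.exists_successor hp
      obtain ⟨j, -, hgj⟩ := h.exists_successor hq
      have hs := h.muHat_sub (h.cyclePoints_subset hgi) (h.cyclePoints_subset hgj) i j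
      rw [mul_g hR, mul_g hR] at hs
      by_cases hji : j = i
      · subst hji
        rw [if_pos rfl] at hs
        refine ⟨(g R l j p, g R l j q), ⟨hgi, hgj⟩, ?_, ?_⟩
        · rw [heq, pow_succ]
          simp only [g]
          field_simp
          ring
        · rw [← hs]; exact hm
      · rw [if_neg hji] at hs
        exact absurd hs hm
  choose p hp heq _ using hiter
  have hfin : (((fun p : ℝ × ℝ => p.2 - p.1) ''
      (cyclePoints R B l ×ˢ cyclePoints R B l))).Finite :=
    (h.finite_cyclePoints.prod h.finite_cyclePoints).image _
  refine hfin.not_infinite (Set.infinite_of_injective_forall_mem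
    (f := fun n => (p n).2 - (p n).1) ?_ fun n => ⟨p n, hp n, rfl⟩)
  intro m n hmn
  simp only at hmn
  have h1 : (R : ℝ) ^ m * ((p n).2 - (p n).1) = (R : ℝ) ^ n * ((p n).2 - (p n).1) := by
    rw [← heq n, ← hmn, ← heq m]
  have h2 : (p n).2 - (p n).1 ≠ 0 := by
    intro h0
    have := heq n
    rw [h0, mul_zero] at this
    exact hcd (by linarith)
  -- Absolute values, since `R` may be negative.
  have h3 := congrArg abs (mul_right_cancel₀ h2 h1)
  rw [abs_pow, abs_pow] at h3
  exact pow_right_injective₀ (by linarith [h.two_le_abs]) (by linarith [h.two_le_abs]) h3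

/-- A cycle point is `l j + R * g_j(c)` for its possible transition `j`, so each digit of `ω` must
be the one that the walk from `c` takes. -/
lemma gWord_eq_of_muHat_ne_zero (h : IsHadamardSystem R B l) {c d : ℝ}
    (hc : c ∈ cyclePoints R B l) (hd : d ∈ cyclePoints R B l) {ω : List (Fin N)}
    (hne : muHat R B (freq R l d ω - c) ≠ 0) :
    gWord R l ω c = d ∧ nuWord R B l ω c ≠ 0 := by
  induction ω generalizing c with
  | nil =>
    rw [freq_nil] at hne
    exact ⟨h.eq_of_muHat_ne_zero hc hd hne, by simp [nuWord]⟩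
  | cons i ω ih =>
    obtain ⟨j, hj, hgj⟩ := h.exists_successor hc
    have hs := h.muHat_sub (h.cyclePoints_subset hgj)
      (freq_mem_unitLattice (R := R) (l := l) d (h.cyclePoints_subset hd) ω) j i
    rw [mul_g h.R_ne_zero, ← freq_cons] at hs
    by_cases hij : i = j
    · subst hij
      rw [if_pos rfl] at hs
      obtain ⟨h1, h2⟩ := ih hgj (by rw [← hs]; exact hne)
      exact ⟨h1, mul_ne_zero hj h2⟩
    · rw [if_neg hij] at hs
      exact absurd hs hne

lemma exists_append_of_muHat_ne_zero (h : IsHadamardSystem R B l) {c d : ℝ}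
    (hc : c ∈ cyclePoints R B l) (hd : d ∈ cyclePoints R B l) {ω ω' : List (Fin N)}
    (hne : muHat R B (freq R l d ω' - freq R l c ω) ≠ 0) :
    ∃ γ, (ω' = ω ++ γ ∧ gWord R l γ c = d ∧ nuWord R B l γ c ≠ 0) ∨
      (ω = ω' ++ γ ∧ gWord R l γ d = c ∧ nuWord R B l γ d ≠ 0) := by
  induction ω generalizing ω' with
  | nil =>
    rw [freq_nil] at hne
    exact ⟨ω', .inl ⟨rfl, h.gWord_eq_of_muHat_ne_zero hc hd hne⟩⟩
  | cons i ω ih =>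
    cases ω' with
    | nil =>
      rw [freq_nil, ← neg_sub, muHat_neg] at hne
      exact ⟨i :: ω, .inr ⟨rfl, h.gWord_eq_of_muHat_ne_zero hd hc fun h0 => hne (by simp [h0])⟩⟩
    | cons j ω' =>
      have hs := h.muHat_sub
        (freq_mem_unitLattice (R := R) (l := l) c (h.cyclePoints_subset hc) ω)
        (freq_mem_unitLattice (R := R) (l := l) d (h.cyclePoints_subset hd) ω') i j
      rw [← freq_cons, ← freq_cons] at hs
      by_cases hji : j = i
      · subst hji
        rw [if_pos rfl] at hs
        obtain ⟨γ, hγ⟩ := ih (ω' := ω') (by rw [← hs]; exact hne)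
        exact ⟨γ, hγ.imp (fun h => ⟨by rw [h.1]; rfl, h.2⟩) fun h => ⟨by rw [h.1]; rfl, h.2⟩⟩
      · rw [if_neg hji] at hs
        exact absurd hs hne

lemma eq_of_mem_OmegaZero (h : IsHadamardSystem R B l)
    (c : {M : Set ℝ // IsMinimalInvariant R B l M} → ℝ) (hc : ∀ M, c M ∈ M.1)
    (p q : Σ M : {M : Set ℝ // IsMinimalInvariant R B l M}, OmegaZero R B l (c M))
    (hne : muHat R B (freq R l (c q.1) q.2 - freq R l (c p.1) p.2) ≠ 0) : p = q := by
  obtain ⟨M, ω, hω⟩ := p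
  obtain ⟨M', ω', hω'⟩ := q
  have key : ∀ (M M' : {M : Set ℝ // IsMinimalInvariant R B l M}) (γ : List (Fin N)),
      gWord R l γ (c M) = c M' → nuWord R B l γ (c M) ≠ 0 → M = M' := fun M M' γ hg hν =>
    Subtype.ext (M.2.eq_of_mem M'.2 (hg ▸ M.2.isInvariant.gWord_mem (hc M) hν) (hc M'))
  have hnil : ∀ (M : {M : Set ℝ // IsMinimalInvariant R B l M}) (ω γ : List (Fin N)),
      ω ++ γ ∈ OmegaZero R B l (c M) → gWord R l γ (c M) = c M → nuWord R B l γ (c M) ≠ 0 →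
      γ = [] := by
    intro M ω γ hmem hg hν
    by_contra hγ
    obtain ⟨β, hβ, hs⟩ := exists_isCycleWord_suffix hγ hg hν
    exact hmem β hβ (hs.trans (List.suffix_append _ _))
  obtain ⟨γ, ⟨rfl, hg, hν⟩ | ⟨rfl, hg, hν⟩⟩ := h.exists_append_of_muHat_ne_zero
    ⟨M.1, M.2, hc M⟩ ⟨M'.1, M'.2, hc M'⟩ hne
  · obtain rfl := key _ _ γ hg hν
    obtain rfl := hnil _ _ γ hω' hg hν
    simp
  · obtain rfl := key _ _ γ hg hν
    obtain rfl := hnil _ _ γ hω hg hν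
    simp

end IsHadamardSystem

/-! ### Uniqueness of Fourier transforms -/

/-- The finite measures with densities `u⁺` and `u⁻` have the same characteristic function, hence
coincide, so `u⁺ = u⁻` almost everywhere. -/
lemma ae_eq_zero_of_integral_expFun_ofReal {μ : Measure ℝ} {u : ℝ → ℝ} (hu : Integrable u μ)
    (h : ∀ t, ∫ x, expFun t x * (u x : ℂ) ∂μ = 0) : u =ᵐ[μ] 0 := by
  have hm := hu.aemeasurable
  have hm1 : AEMeasurable (fun x => ENNReal.ofReal (u x)) μ := hm.ennreal_ofReal
  have hm2 : AEMeasurable (fun x => ENNReal.ofReal (-u x)) μ := hm.neg.ennreal_ofReal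
  have hf1 : ∫⁻ x, ENNReal.ofReal (u x) ∂μ ≠ ⊤ := hu.lintegral_lt_top.ne
  have hf2 : ∫⁻ x, ENNReal.ofReal (-u x) ∂μ ≠ ⊤ := hu.neg.lintegral_lt_top.ne
  have : IsFiniteMeasure (μ.withDensity fun x => ENNReal.ofReal (u x)) :=
    isFiniteMeasure_withDensity hf1
  have : IsFiniteMeasure (μ.withDensity fun x => ENNReal.ofReal (-u x)) :=
    isFiniteMeasure_withDensity hf2
  have heq : (μ.withDensity fun x => ENNReal.ofReal (u x)) =
      μ.withDensity fun x => ENNReal.ofReal (-u x) := by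
    refine Measure.ext_of_charFun (funext fun t => ?_)
    rw [charFun_apply_real, charFun_apply_real,
      integral_withDensity_eq_integral_toReal_smul₀ hm1 (.of_forall fun _ => ENNReal.ofReal_lt_top),
      integral_withDensity_eq_integral_toReal_smul₀ hm2 (.of_forall fun _ => ENNReal.ofReal_lt_top),
      ← sub_eq_zero]
    have hb : ∀ w : ℝ → ℝ, Integrable w μ →
        Integrable (fun x => w x • Complex.exp (t * x * Complex.I)) μ := by
      intro w hw
      refine hw.smul_bdd (f := fun x : ℝ => Complex.exp (t * x * Complex.I)) 1
        (Continuous.aestronglyMeasurable (by fun_prop))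
        (.of_forall fun x => ?_)
      rw [← Complex.ofReal_mul, Complex.norm_exp_ofReal_mul_I]
    rw [← integral_sub]
    · rw [← h (t / (2 * Real.pi))]
      refine integral_congr_ae (.of_forall fun x => ?_)
      simp only [Complex.real_smul, ENNReal.toReal_ofReal']
      rw [← sub_mul, ← Complex.ofReal_sub, max_zero_sub_eq_self, mul_comm]
      congr 1
      unfold expFun
      congr 1
      have := Real.pi_ne_zero
      push_cast
      field_simp
    · exact hb _ (by simpa only [ENNReal.toReal_ofReal'] using hu.pos_part)
    · exact hb _ (by simpa only [ENNReal.toReal_ofReal'] using hu.neg_part)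
  rw [withDensity_eq_iff hm1 hm2 hf1] at heq
  filter_upwards [heq] with x hx
  have h1 : max (u x) 0 = max (-u x) 0 := by
    rw [← ENNReal.toReal_ofReal', ← ENNReal.toReal_ofReal', hx]
  have := max_zero_sub_eq_self (u x)
  rw [h1, sub_self] at this
  simpa using this.symm

lemma ae_eq_zero_of_integral_expFun {μ : Measure ℝ} {f : ℝ → ℂ} (hf : Integrable f μ)
    (h : ∀ t, ∫ x, expFun t x * f x ∂μ = 0) : f =ᵐ[μ] 0 := by
  have hmul : ∀ (t : ℝ) (w : ℝ → ℂ), Integrable w μ → Integrable (fun x => expFun t x * w x) μ :=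
    fun t w hw => hw.bdd_mul (c := 1) (continuous_expFun t).aestronglyMeasurable
      (.of_forall fun x => (norm_expFun t x).le)
  have hconj : ∀ t, ∫ x, expFun t x * conj (f x) ∂μ = 0 := by
    intro t
    have h1 := congrArg conj (h (-t))
    rw [← integral_conj, map_zero] at h1
    rw [← h1]
    refine integral_congr_ae (.of_forall fun x => ?_)
    simp only [map_mul, conj_expFun, neg_neg]
  have hfc : Integrable (fun x => conj (f x)) μ :=
    Complex.conjCLE.toContinuousLinearMap.integrable_comp hf
  have hre : (fun x => (f x).re) =ᵐ[μ] 0 := by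
    refine ae_eq_zero_of_integral_expFun_ofReal hf.re fun t => ?_
    have h1 : ∀ x, expFun t x * ((f x).re : ℂ) =
        (1 / 2) * (expFun t x * f x + expFun t x * conj (f x)) := fun x => by
      rw [← mul_add, Complex.add_conj]; push_cast; ring
    simp_rw [h1]
    rw [integral_const_mul, integral_add (hmul t _ hf) (hmul t _ hfc), h, hconj]
    simp
  have him : (fun x => (f x).im) =ᵐ[μ] 0 := by
    refine ae_eq_zero_of_integral_expFun_ofReal hf.im fun t => ?_
    have h1 : ∀ x, expFun t x * ((f x).im : ℂ) =
        (1 / (2 * Complex.I)) * (expFun t x * f x - expFun t x * conj (f x)) := fun x => by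
      rw [← mul_sub, Complex.sub_conj]; push_cast; field_simp
    simp_rw [h1]
    rw [integral_const_mul, integral_sub (hmul t _ hf) (hmul t _ hfc), h, hconj]
    simp
  filter_upwards [hre, him] with x h1 h2
  exact Complex.ext h1 h2

/-! ### Exponentials as elements of `L²` -/

/-- The exponential `e_t` as a bounded continuous function. -/
def expBCF (t : ℝ) : BoundedContinuousFunction ℝ ℂ :=
  BoundedContinuousFunction.ofNormedAddCommGroup (expFun t) (continuous_expFun t) 1
    fun x => (norm_expFun t x).le

@[simp] lemma expBCF_apply (t x : ℝ) : expBCF t x = expFun t x := rfl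

/-- The exponential `e_t` as an element of `L²(μ)`. -/
def expLp (μ : Measure ℝ) [IsFiniteMeasure μ] (t : ℝ) : Lp ℂ 2 μ :=
  BoundedContinuousFunction.toLp 2 μ ℂ (expBCF t)

section

variable (μ : Measure ℝ) [IsFiniteMeasure μ]

lemma coeFn_expLp (t : ℝ) : expLp μ t =ᵐ[μ] expFun t :=
  BoundedContinuousFunction.coeFn_toLp 2 μ ℂ (expBCF t)

lemma inner_expLp (s t : ℝ) : inner ℂ (expLp μ s) (expLp μ t) = ∫ x, expFun (t - s) x ∂μ := by
  unfold expLp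
  rw [BoundedContinuousFunction.inner_toLp]
  refine integral_congr_ae (.of_forall fun x => ?_)
  simp only [expBCF_apply]
  rw [conj_expFun, ← expFun_add_left, sub_eq_add_neg]

/-- Smoothness `⊤` means analyticity here. Truncating `x` outside the support changes nothing almost
everywhere and makes `a = 2πix` bounded, so `e_t` is the image of `exp (t • a)`, with the
exponential of a Banach algebra. -/
lemma contDiff_expLp {C : ℝ} (hC : ∀ᵐ x ∂μ, |x| ≤ C) : ContDiff ℝ ⊤ (expLp μ) := by
  have hcl : ∀ x : ℝ, |max (-|C|) (min x |C|)| ≤ |C| := fun x => by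
    rw [abs_le]
    exact ⟨le_max_left _ _, max_le (by linarith [abs_nonneg C]) (min_le_right _ _)⟩
  let a : BoundedContinuousFunction ℝ ℂ := BoundedContinuousFunction.ofNormedAddCommGroup
    (fun x : ℝ => 2 * Real.pi * Complex.I * (max (-|C|) (min x |C|) : ℝ)) (by fun_prop)
    (2 * Real.pi * |C|) (fun x => by
      have := hcl x
      simp only [Complex.norm_mul, Complex.norm_ofNat, Complex.norm_real, Complex.norm_I,
        Real.norm_eq_abs, abs_of_pos Real.pi_pos, mul_one]
      gcongr)
  have hexp : ∀ (t x : ℝ), NormedSpace.exp (t • a) x = Complex.exp ((t : ℂ) * a x) := by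
    intro t x
    let ev : BoundedContinuousFunction ℝ ℂ →+* ℂ :=
      { toFun := fun f => f x
        map_one' := rfl
        map_mul' := fun _ _ => rfl
        map_zero' := rfl
        map_add' := fun _ _ => rfl }
    have hev : Continuous ev := (BoundedContinuousFunction.lipschitz_eval_const x).continuous
    have h1 := NormedSpace.map_exp ev hev (t • a)
    rw [← Complex.exp_eq_exp_ℂ] at h1
    refine h1.trans ?_
    congr 1
  have heq : expLp μ = fun t : ℝ => BoundedContinuousFunction.toLp 2 μ ℂ
      (NormedSpace.exp (t • a)) := by
    funext t
    refine Lp.ext ?_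
    filter_upwards [coeFn_expLp μ t,
      BoundedContinuousFunction.coeFn_toLp 2 μ ℂ (NormedSpace.exp (t • a)), hC] with x h1 h2 h3
    rw [h1, h2, hexp]
    have h4 : max (-|C|) (min x |C|) = x := by
      have h5 := abs_le.1 (h3.trans (le_abs_self C))
      rw [min_eq_left h5.2, max_eq_right h5.1]
    simp only [a, BoundedContinuousFunction.coe_ofNormedAddCommGroup, h4, expFun]
    congr 1; ring
  rw [heq]
  have h1 : ContDiff ℝ ⊤ (NormedSpace.exp : BoundedContinuousFunction ℝ ℂ → _) := by
    rw [contDiff_omega_iff_analyticOnNhd]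
    exact fun x _ => NormedSpace.exp_analytic (𝕂 := ℝ) x
  have h2 : ContDiff ℝ ⊤ fun t : ℝ => t • a := contDiff_id.smul contDiff_const
  exact ((BoundedContinuousFunction.toLp 2 μ ℂ).restrictScalars ℝ).contDiff.comp (h1.comp h2)

variable {μ}

lemma topologicalClosure_span_expLp :
    (Submodule.span ℂ (Set.range (expLp μ))).topologicalClosure = ⊤ := by
  rw [Submodule.topologicalClosure_eq_top_iff, Submodule.eq_bot_iff]
  intro f hf
  have hint : Integrable f μ := (Lp.memLp f).integrable (by norm_num)
  refine Lp.ext ((ae_eq_zero_of_integral_expFun hint fun t => ?_).trans (Lp.coeFn_zero _ _ _).symm)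
  have h1 := (Submodule.mem_orthogonal _ _).1 hf (expLp μ (-t))
    (Submodule.subset_span ⟨_, rfl⟩)
  rw [L2.inner_def] at h1
  rw [← h1]
  refine integral_congr_ae ?_
  filter_upwards [coeFn_expLp μ (-t)] with x hx
  rw [hx, RCLike.inner_apply, conj_expFun, neg_neg, mul_comm]

end

/-! ### The invariant measure has bounded support -/

lemma IsInvariantMeasure.measureReal_eq {R : ℤ} {B : Finset ℤ} {μ : Measure ℝ}
    (h : IsInvariantMeasure R B μ) {s : Set ℝ} (hs : MeasurableSet s) :
    μ.real s = (1 / (B.card : ℝ)) * ∑ b ∈ B, μ.real (tau R b ⁻¹' s) := by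
  have := h.isProbabilityMeasure
  have h1 := h.integral_eq (s.indicator fun _ => (1 : ℂ)) (measurable_const.indicator hs)
    ⟨1, fun x => by by_cases hx : x ∈ s <;> simp [hx]⟩
  have h2 : ∀ b : ℤ, (fun x => s.indicator (fun _ => (1 : ℂ)) (tau R b x)) =
      (tau R b ⁻¹' s).indicator fun _ => (1 : ℂ) := fun b => rfl
  simp_rw [h2] at h1
  rw [integral_indicator_const _ hs] at h1
  simp_rw [fun b : ℤ => integral_indicator_const (μ := μ) (1 : ℂ) (measurable_tau R b hs)] at h1
  simp only [Complex.real_smul, mul_one] at h1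
  rw [← Complex.ofReal_sum] at h1
  apply Complex.ofReal_injective
  rw [h1]
  push_cast
  rfl

lemma IsInvariantMeasure.ae_abs_le {R : ℤ} (hR : 1 < |R|) {B : Finset ℤ} (hB : B.Nonempty)
    {μ : Measure ℝ} (h : IsInvariantMeasure R B μ) :
    ∀ᵐ x ∂μ, |x| ≤ ∑ b ∈ B, |(b : ℝ)| := by
  have := h.isProbabilityMeasure
  set L := ∑ b ∈ B, |(b : ℝ)| with hL
  have hR2 : (2 : ℝ) ≤ |(R : ℝ)| := by
    have : 2 ≤ |R| := by omega
    exact_mod_cast this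
  have hN : (0 : ℝ) < B.card := by exact_mod_cast hB.card_pos
  have hmeas : ∀ r : ℝ, MeasurableSet {x : ℝ | r < |x|} := fun r =>
    measurableSet_lt measurable_const measurable_id.abs
  -- Since `|R| ≥ 2`, a point can land beyond `L + δ` only from beyond `L + 2δ`; iterating pushes
  -- the tail to infinity.
  have step : ∀ δ : ℝ, 0 ≤ δ → μ.real {x | L + δ < |x|} ≤ μ.real {x | L + 2 * δ < |x|} := by
    intro δ hδ
    rw [h.measureReal_eq (hmeas _)]
    have h1 : ∀ b ∈ B, μ.real (tau R b ⁻¹' {x | L + δ < |x|}) ≤ μ.real {x | L + 2 * δ < |x|} := by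
      intro b hb
      refine measureReal_mono fun x hx => ?_
      have hx' : L + δ < |(x + b) / R| := hx
      rw [abs_div, lt_div_iff₀ (by linarith)] at hx'
      have h2 : |x + b| ≤ |x| + L := (abs_add_le _ _).trans (add_le_add le_rfl
        (Finset.single_le_sum (f := fun b : ℤ => |(b : ℝ)|) (fun _ _ => abs_nonneg _) hb))
      have hL0 : 0 ≤ L := Finset.sum_nonneg fun _ _ => abs_nonneg _
      have h3 : (L + δ) * 2 ≤ (L + δ) * |(R : ℝ)| := by gcongr
      change L + 2 * δ < |x|
      linarith
    calc (1 / (B.card : ℝ)) * ∑ b ∈ B, μ.real (tau R b ⁻¹' {x | L + δ < |x|})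
        ≤ (1 / (B.card : ℝ)) * ∑ b ∈ B, μ.real {x | L + 2 * δ < |x|} := by
          exact mul_le_mul_of_nonneg_left (Finset.sum_le_sum h1) (by positivity)
      _ = _ := by rw [Finset.sum_const, nsmul_eq_mul]; field_simp
  have hzero : ∀ δ : ℝ, 0 < δ → μ.real {x | L + δ < |x|} = 0 := by
    intro δ hδ
    have hiter : ∀ n : ℕ, μ.real {x | L + δ < |x|} ≤ μ.real {x | L + 2 ^ n * δ < |x|} := by
      intro n
      induction n with
      | zero => simp
      | succ n ih =>
        refine ih.trans ((step _ (by positivity)).trans (le_of_eq ?_))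
        rw [pow_succ', mul_assoc]
    have hlim : Filter.Tendsto (fun n : ℕ => μ.real {x | L + 2 ^ n * δ < |x|}) Filter.atTop
        (nhds 0) := by
      have hanti : Antitone fun n : ℕ => {x : ℝ | L + 2 ^ n * δ < |x|} := by
        intro m n hmn x hx
        refine lt_of_le_of_lt ?_ (show L + 2 ^ n * δ < |x| from hx)
        gcongr
        norm_num
      have h1 := tendsto_measure_iInter_atTop (μ := μ)
        (s := fun n : ℕ => {x : ℝ | L + 2 ^ n * δ < |x|})
        (fun n => (hmeas _).nullMeasurableSet) hanti ⟨0, measure_ne_top _ _⟩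
      have h2 : ⋂ n : ℕ, {x : ℝ | L + 2 ^ n * δ < |x|} = ∅ := by
        refine Set.eq_empty_of_forall_notMem fun x hx => ?_
        rw [Set.mem_iInter] at hx
        obtain ⟨n, hn⟩ := pow_unbounded_of_one_lt ((|x| - L) / δ) one_lt_two
        rw [div_lt_iff₀ hδ] at hn
        have : L + 2 ^ n * δ < |x| := hx n
        linarith
      rw [h2, measure_empty] at h1
      have h3 := (ENNReal.tendsto_toReal ENNReal.zero_ne_top).comp h1
      simpa [Measure.real, Function.comp_def] using h3
    exact le_antisymm (ge_of_tendsto' hlim hiter) measureReal_nonneg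
  have hall : ∀ᵐ x ∂μ, ∀ n : ℕ, |x| ≤ L + 1 / ((n : ℝ) + 1) := by
    rw [ae_all_iff]
    intro n
    have h1 := hzero (1 / ((n : ℝ) + 1)) (by positivity)
    rw [measureReal_eq_zero_iff] at h1
    rw [ae_iff]
    simpa only [not_le] using h1
  filter_upwards [hall] with x hx
  have hlim : Filter.Tendsto (fun n : ℕ => L + 1 / ((n : ℝ) + 1)) Filter.atTop (nhds (L + 0)) :=
    tendsto_one_div_add_atTop_nhds_zero_nat.const_add L
  rw [add_zero] at hlim
  exact ge_of_tendsto' hlim hx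

/-! ### Finite combinations of exponentials -/

section Transfer

variable {N : ℕ} (R : ℤ) (B : Finset ℤ) (l : Fin N → ℤ)

/-- The action `e_t ↦ ν_i(t) e_{g_i(t)}` on formal combinations of exponentials. -/
def transfer (i : Fin N) : (ℝ →₀ ℂ) →ₗ[ℂ] (ℝ →₀ ℂ) :=
  Finsupp.linearCombination ℂ fun t => Finsupp.single (g R l i t) (nu R B l i t)

/-- The action `e_t ↦ e_{l_i + R t}` on formal combinations of exponentials. -/
def branch (i : Fin N) : (ℝ →₀ ℂ) →ₗ[ℂ] (ℝ →₀ ℂ) :=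
  Finsupp.lmapDomain ℂ ℂ fun t => l i + R * t

/-- All frequencies of words that end in a point of a minimal invariant set. -/
def cycleFreqs : Set ℝ := {t | ∃ c ∈ cyclePoints R B l, ∃ ω, freq R l c ω = t}

variable {R B l}

@[simp] lemma transfer_single (i : Fin N) (t : ℝ) (a : ℂ) :
    transfer R B l i (Finsupp.single t a) = Finsupp.single (g R l i t) (a * nu R B l i t) := by
  simp [transfer]

@[simp] lemma branch_single (i : Fin N) (t : ℝ) (a : ℂ) :
    branch R l i (Finsupp.single t a) = Finsupp.single (l i + R * t) a := by
  simp [branch]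

lemma mem_cycleFreqs_of_mem {c : ℝ} (hc : c ∈ cyclePoints R B l) : c ∈ cycleFreqs R B l :=
  ⟨c, hc, [], by simp⟩

lemma branch_mem_cycleFreqs {t : ℝ} (ht : t ∈ cycleFreqs R B l) (i : Fin N) :
    l i + R * t ∈ cycleFreqs R B l := by
  obtain ⟨c, hc, ω, rfl⟩ := ht
  exact ⟨c, hc, i :: ω, freq_cons c i ω⟩

lemma branch_mem_supported {v : ℝ →₀ ℂ} (hv : v ∈ Finsupp.supported ℂ ℂ (cycleFreqs R B l))
    (i : Fin N) : branch R l i v ∈ Finsupp.supported ℂ ℂ (cycleFreqs R B l) := by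
  rw [Finsupp.supported_eq_span_single] at hv
  induction hv using Submodule.span_induction with
  | mem x hx =>
    obtain ⟨t, ht, rfl⟩ := hx
    simpa using Finsupp.single_mem_supported ℂ _ (branch_mem_cycleFreqs ht i)
  | zero => simp
  | add x y _ _ hx hy => rw [map_add]; exact add_mem hx hy
  | smul a x _ hx => rw [map_smul]; exact Submodule.smul_mem _ _ hx

end Transfer

namespace IsHadamardSystem

variable {N : ℕ} {R : ℤ} {B : Finset ℤ} {l : Fin N → ℤ}

lemma cycleFreqs_subset (h : IsHadamardSystem R B l) : cycleFreqs R B l ⊆ unitLattice B := by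
  rintro _ ⟨c, hc, ω, rfl⟩
  exact freq_mem_unitLattice c (h.cyclePoints_subset hc) ω

/-- The Cuntz relation `S_j* S_i = δ_ij`, on formal combinations so that no operator on `L²` is
needed. Lattice frequencies are essential to it. -/
lemma transfer_branch (h : IsHadamardSystem R B l) {v : ℝ →₀ ℂ}
    (hv : v ∈ Finsupp.supported ℂ ℂ (cycleFreqs R B l)) (i j : Fin N) :
    transfer R B l j (branch R l i v) = if i = j then v else 0 := by
  rw [Finsupp.supported_eq_span_single] at hv
  induction hv using Submodule.span_induction with
  | mem x hx =>
    obtain ⟨t, ht, rfl⟩ := hx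
    have hR := h.R_ne_zero
    have hg : g R l j (l i + R * t) = ((l i : ℝ) - l j) / R + t := by
      unfold g; field_simp; ring
    rw [branch_single, transfer_single, nu, hg, mB_add_of_mem (h.cycleFreqs_subset ht), h.mB_eq]
    split_ifs with hij
    · subst hij; simp
    · simp
  | zero => simp
  | add x y _ _ hx hy => rw [map_add, map_add, hx, hy]; split_ifs <;> simp
  | smul a x _ hx => rw [map_smul, map_smul, hx]; split_ifs <;> simp

/-! ### A maximum principle -/

/-- The maximisers of `D` on an invariant interval form an invariant set. If it is finite it
contains a minimal invariant set, where `D = 0`. If it is infinite it accumulates, so the analytic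
`D` is constant, equal to its value at the cycle point `0`. -/
lemma eq_zero_of_subharmonic (h : IsHadamardSystem R B l) {D : ℝ → ℝ} (hD : ContDiff ℝ ⊤ D)
    (hD0 : ∀ t, 0 ≤ D t) (hsub : ∀ t, D t ≤ ∑ i, ‖nu R B l i t‖ ^ 2 * D (g R l i t))
    (hcyc : ∀ c ∈ cyclePoints R B l, D c = 0) (t : ℝ) : D t = 0 := by
  set L := ∑ j, |(l j : ℝ)| with hL
  -- Then `[-r, r]` contains `t` and every `g_i` maps it into itself.
  set r := max |t| L with hr
  have hr0 : 0 ≤ r := (abs_nonneg t).trans (le_max_left _ _)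
  have hI : ∀ i, ∀ s ∈ Set.Icc (-r) r, g R l i s ∈ Set.Icc (-r) r := by
    intro i s hs
    have h1 := h.abs_g_le i s
    have h2 : |s| ≤ r := abs_le.2 hs
    have h3 : L ≤ r := le_max_right _ _
    exact abs_le.1 (by linarith)
  obtain ⟨x, hx, hmax⟩ := (isCompact_Icc (a := -r) (b := r)).exists_isMaxOn
    ⟨0, by linarith, hr0⟩ hD.continuous.continuousOn
  have hmax' : ∀ s ∈ Set.Icc (-r) r, D s ≤ D x := fun s hs => hmax hs
  suffices hDx : D x = 0 by
    exact le_antisymm (hDx ▸ hmax' t (abs_le.1 (le_max_left _ _))) (hD0 t)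
  let Z : Set ℝ := {s | s ∈ Set.Icc (-r) r ∧ D s = D x}
  have hZ : IsInvariant R B l Z := by
    rintro s ⟨hs, hsx⟩ i hi
    refine ⟨hI i s hs, le_antisymm (hmax' _ (hI i s hs)) ?_⟩
    by_contra! hlt
    have h1 : ∑ j, ‖nu R B l j s‖ ^ 2 * D (g R l j s) < ∑ j, ‖nu R B l j s‖ ^ 2 * D x := by
      refine Finset.sum_lt_sum (fun j _ => mul_le_mul_of_nonneg_left (hmax' _ (hI j s hs))
        (by positivity)) ⟨i, Finset.mem_univ i, mul_lt_mul_of_pos_left hlt ?_⟩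
      have := norm_pos_iff.2 hi
      positivity
    rw [← Finset.sum_mul, h.sum_norm_nu_sq, one_mul] at h1
    linarith [hsub s]
  by_cases hfin : Z.Finite
  · obtain ⟨M, hMZ, hM⟩ := exists_isMinimalInvariant_subset hfin ⟨x, hx, rfl⟩ hZ
    obtain ⟨c, hc⟩ := hM.prop.1
    rw [← (hMZ hc).2]
    exact hcyc c ⟨M, hM, hc⟩
  · obtain ⟨z, -, hz⟩ := Set.Infinite.exists_accPt_of_subset_isCompact hfin
      (isCompact_Icc (a := -r) (b := r)) fun s hs => hs.1
    have hfr : ∃ᶠ s in nhdsWithin z {z}ᶜ, D s = (fun _ => D x) s :=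
      (accPt_iff_frequently_nhdsNE.1 hz).mono fun s hs => hs.2
    have heq := AnalyticOnNhd.eq_of_frequently_eq (contDiff_omega_iff_analyticOnNhd.1 hD)
      analyticOnNhd_const hfr
    rw [← hcyc 0 h.zero_mem_cyclePoints, heq]

/-! ### Completeness -/

variable [IsProbabilityMeasure (invariantMeasure R B)]

/-- The relation `∑ S_i S_i* = 1`, in terms of inner products. -/
lemma inner_linearCombination (h : IsHadamardSystem R B l) (u v : ℝ →₀ ℂ) :
    inner ℂ (Finsupp.linearCombination ℂ (expLp (invariantMeasure R B)) u)
      (Finsupp.linearCombination ℂ (expLp (invariantMeasure R B)) v) =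
    ∑ i, inner ℂ
      (Finsupp.linearCombination ℂ (expLp (invariantMeasure R B)) (transfer R B l i u))
      (Finsupp.linearCombination ℂ (expLp (invariantMeasure R B)) (transfer R B l i v)) := by
  induction u using Finsupp.induction_linear with
  | zero => simp
  | add u u' hu hu' => simp only [map_add, inner_add_left, hu, hu', Finset.sum_add_distrib]
  | single s a =>
    induction v using Finsupp.induction_linear with
    | zero => simp
    | add v v' hv hv' => simp only [map_add, inner_add_right, hv, hv', Finset.sum_add_distrib]
    | single t b =>
      simp only [transfer_single, Finsupp.linearCombination_single, inner_smul_left,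
        inner_smul_right, inner_expLp]
      have h1 := h.muHat_eq (t - s)
      have h2 : ∀ i, g R l i t - g R l i s = (t - s) / R := fun i => by unfold g; ring
      unfold muHat at h1
      simp_rw [h2, h1, ← h.sum_conj_nu_mul_nu s t, Finset.sum_mul, Finset.mul_sum, map_mul]
      exact Finset.sum_congr rfl fun i _ => by ring

/-- Approximating each successor exponential by `v j` and recombining through the branches gives an
approximation of `e_t` whose squared error is exactly the weighted sum of the errors. -/
lemma norm_sq_expLp_sub (h : IsHadamardSystem R B l) (t : ℝ) {v : Fin N → ℝ →₀ ℂ}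
    (hv : ∀ i, v i ∈ Finsupp.supported ℂ ℂ (cycleFreqs R B l)) :
    ‖expLp (invariantMeasure R B) t - Finsupp.linearCombination ℂ (expLp (invariantMeasure R B))
      (∑ i, nu R B l i t • branch R l i (v i))‖ ^ 2 =
    ∑ j, ‖nu R B l j t‖ ^ 2 * ‖expLp (invariantMeasure R B) (g R l j t) -
      Finsupp.linearCombination ℂ (expLp (invariantMeasure R B)) (v j)‖ ^ 2 := by
  set Φ := Finsupp.linearCombination ℂ (expLp (invariantMeasure R B)) with hΦ
  set u : ℝ →₀ ℂ := Finsupp.single t 1 - ∑ i, nu R B l i t • branch R l i (v i) with hu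
  have hu1 : expLp (invariantMeasure R B) t - Φ (∑ i, nu R B l i t • branch R l i (v i)) = Φ u := by
    rw [hu, map_sub, hΦ, Finsupp.linearCombination_single, one_smul]
  have hT : ∀ j, Φ (transfer R B l j u) =
      nu R B l j t • (expLp (invariantMeasure R B) (g R l j t) - Φ (v j)) := by
    intro j
    have h1 : transfer R B l j u = nu R B l j t • (Finsupp.single (g R l j t) 1 - v j) := by
      rw [hu, map_sub, map_sum]
      simp_rw [map_smul, h.transfer_branch (hv _)]
      simp [smul_sub]
    rw [h1, map_smul, map_sub, hΦ, Finsupp.linearCombination_single, one_smul]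
  have h2 := h.inner_linearCombination u u
  rw [← hΦ, inner_self_eq_norm_sq_to_K] at h2
  simp_rw [inner_self_eq_norm_sq_to_K, hT, norm_smul] at h2
  simp_rw [← mul_pow]
  rw [hu1]
  exact_mod_cast h2

lemma topologicalClosure_span_cycleFreqs (h : IsHadamardSystem R B l) :
    (Submodule.span ℂ (expLp (invariantMeasure R B) '' cycleFreqs R B l)).topologicalClosure =
      ⊤ := by
  set E := expLp (invariantMeasure R B) with hE
  set K := (Submodule.span ℂ (E '' cycleFreqs R B l)).topologicalClosure with hK
  have hKc : IsClosed (K : Set (Lp ℂ 2 (invariantMeasure R B))) :=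
    Submodule.isClosed_topologicalClosure _
  have : CompleteSpace K := hKc.completeSpace_coe
  let Q := Kᗮ.starProjection
  have hQK : ∀ k ∈ K, Q k = 0 := fun k hk => by
    rw [Submodule.starProjection_apply_eq_zero_iff, Submodule.orthogonal_orthogonal]
    exact hk
  have hmemK : ∀ t ∈ cycleFreqs R B l, E t ∈ K := fun t ht =>
    Submodule.le_topologicalClosure _ (Submodule.subset_span ⟨t, ht, rfl⟩)
  have hD : ContDiff ℝ ⊤ fun t => ‖Q (E t)‖ ^ 2 :=
    ((Q.restrictScalars ℝ).contDiff.comp (contDiff_expLp _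
      (h.isInvariantMeasure.ae_abs_le h.one_lt_abs h.nonempty))).norm_sq ℂ
  have hsub : ∀ t, ‖Q (E t)‖ ^ 2 ≤ ∑ i, ‖nu R B l i t‖ ^ 2 * ‖Q (E (g R l i t))‖ ^ 2 := by
    intro t
    -- The projection onto `K` need not be a finite combination, so it is approximated within `ε`.
    have hε : ∀ ε : ℝ, 0 < ε →
        ‖Q (E t)‖ ^ 2 ≤ ∑ i, ‖nu R B l i t‖ ^ 2 * (‖Q (E (g R l i t))‖ + ε) ^ 2 := by
      intro ε hε
      have hex : ∀ i, ∃ v ∈ Finsupp.supported ℂ ℂ (cycleFreqs R B l),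
          ‖E (g R l i t) - Finsupp.linearCombination ℂ E v‖ ≤ ‖Q (E (g R l i t))‖ + ε := by
        intro i
        have hP : K.starProjection (E (g R l i t)) ∈
            closure (Submodule.span ℂ (E '' cycleFreqs R B l) : Set _) :=
          Submodule.starProjection_apply_mem K _
        obtain ⟨w, hw, hdist⟩ := Metric.mem_closure_iff.1 hP ε hε
        obtain ⟨v, hv, rfl⟩ := (Finsupp.mem_span_image_iff_linearCombination ℂ).1 hw
        refine ⟨v, hv, ?_⟩
        have hQP : Q (E (g R l i t)) = E (g R l i t) - K.starProjection (E (g R l i t)) :=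
          Submodule.starProjection_orthogonal_val _
        rw [hQP]
        rw [dist_eq_norm] at hdist
        refine (norm_sub_le_norm_sub_add_norm_sub _ (K.starProjection (E (g R l i t))) _).trans ?_
        gcongr
      choose v hv hle using hex
      have hmem : Finsupp.linearCombination ℂ E (∑ i, nu R B l i t • branch R l i (v i)) ∈ K := by
        refine Submodule.le_topologicalClosure _ ?_
        rw [Finsupp.mem_span_image_iff_linearCombination]
        exact ⟨_, Submodule.sum_mem _ fun i _ =>
          Submodule.smul_mem _ _ (branch_mem_supported (hv i) i), rfl⟩
      have h1 : ‖Q (E t)‖ ≤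
          ‖E t - Finsupp.linearCombination ℂ E (∑ i, nu R B l i t • branch R l i (v i))‖ := by
        rw [← sub_zero (Q (E t)), ← hQK _ hmem, ← map_sub]
        exact Submodule.norm_starProjection_apply_le _ _
      calc ‖Q (E t)‖ ^ 2 ≤ _ := pow_le_pow_left₀ (norm_nonneg _) h1 2
        _ = _ := h.norm_sq_expLp_sub t hv
        _ ≤ _ := Finset.sum_le_sum fun i _ => mul_le_mul_of_nonneg_left
            (pow_le_pow_left₀ (norm_nonneg _) (hle i) 2) (by positivity)
    have hlim : Filter.Tendsto
        (fun ε : ℝ => ∑ i, ‖nu R B l i t‖ ^ 2 * (‖Q (E (g R l i t))‖ + ε) ^ 2)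
        (nhdsWithin 0 (Set.Ioi 0)) (nhds (∑ i, ‖nu R B l i t‖ ^ 2 * ‖Q (E (g R l i t))‖ ^ 2)) := by
      have hc : Continuous
          fun ε : ℝ => ∑ i, ‖nu R B l i t‖ ^ 2 * (‖Q (E (g R l i t))‖ + ε) ^ 2 := by fun_prop
      have := hc.tendsto 0
      simp only [add_zero] at this
      exact this.mono_left nhdsWithin_le_nhds
    exact ge_of_tendsto hlim (Filter.eventually_of_mem self_mem_nhdsWithin hε)
  have hzero := h.eq_zero_of_subharmonic hD (fun t => by positivity) hsub fun c hc => by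
    simp [hQK _ (hmemK c (mem_cycleFreqs_of_mem hc))]
  have hall : ∀ t, E t ∈ K := by
    intro t
    have h1 : Q (E t) = 0 := by simpa using hzero t
    rw [Submodule.starProjection_apply_eq_zero_iff, Submodule.orthogonal_orthogonal] at h1
    exact h1
  rw [eq_top_iff, ← topologicalClosure_span_expLp (μ := invariantMeasure R B)]
  refine Submodule.topologicalClosure_minimal _ (Submodule.span_le.2 ?_) hKc
  rintro _ ⟨t, rfl⟩
  exact hall t

end IsHadamardSystem

end

end FractalFourier

theorem corollary4p8 {N : ℕ} [NeZero N] (R : ℤ) (hR : 1 < |R|)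
    (B : Finset ℤ) (hB0 : (0 : ℤ) ∈ B) (hBN : B.card = N)
    (l : Fin N → ℤ) (hl0 : l 0 = 0)
    (hU : hadamardMatrix R B l * (hadamardMatrix R B l).conjTranspose = 1 ∧
      (hadamardMatrix R B l).conjTranspose * hadamardMatrix R B l = 1)
    (c : {M : Set ℝ // IsMinimalInvariant R B l M} → ℝ) (hc : ∀ M, c M ∈ M.1) :
    {M : Set ℝ | IsMinimalInvariant R B l M}.Finite ∧
    ∃ e : HilbertBasis (Σ M : {M : Set ℝ // IsMinimalInvariant R B l M}, OmegaZero R B l (c M))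
        ℂ (Lp ℂ 2 (invariantMeasure R B)),
      ∀ p, e p =ᵐ[invariantMeasure R B] expFun (freq R l (c p.1) p.2) := by
  have h : IsHadamardSystem R B l := isHadamardSystem R hR B hB0 hBN l hl0 hU
  have := h.isProbabilityMeasure
  refine ⟨h.finite_minimalInvariant, ?_⟩
  let v : (Σ M : {M : Set ℝ // IsMinimalInvariant R B l M}, OmegaZero R B l (c M)) →
      Lp ℂ 2 (invariantMeasure R B) :=
    fun p => expLp (invariantMeasure R B) (freq R l (c p.1) p.2)
  have hv : Orthonormal ℂ v := by
    classical
    rw [orthonormal_iff_ite]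
    intro p q
    have hin : inner ℂ (v p) (v q) = muHat R B (freq R l (c q.1) q.2 - freq R l (c p.1) p.2) :=
      inner_expLp _ _ _
    rw [hin]
    split_ifs with hpq
    · subst hpq
      rw [sub_self, h.muHat_zero]
    · by_contra hne
      exact hpq (h.eq_of_mem_OmegaZero c hc p q hne)
  have hsp : ⊤ ≤ (Submodule.span ℂ (Set.range v)).topologicalClosure := by
    rw [← h.topologicalClosure_span_cycleFreqs]
    refine Submodule.topologicalClosure_mono (Submodule.span_mono ?_)
    rintro _ ⟨_, ⟨d, ⟨M, hM, hd⟩, ω, rfl⟩, rfl⟩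
    -- A path `γ` from `d` to the chosen point rewrites `d` as a frequency over that point.
    obtain ⟨γ, -, hγ⟩ := hM.exists_word hd (hc ⟨M, hM⟩)
    have hfr : freq R l (c ⟨M, hM⟩) γ = d := by rw [← hγ, freq_gWord h.R_ne_zero]
    obtain ⟨β, hβ, hβ'⟩ := exists_mem_OmegaZero (B := B) (l := l) h.R_ne_zero (c ⟨M, hM⟩) (ω ++ γ)
    rw [freq_append, hfr] at hβ'
    exact ⟨⟨⟨M, hM⟩, β, hβ⟩, by rw [← hβ']⟩
  refine ⟨HilbertBasis.mk hv hsp, fun p => ?_⟩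
  rw [HilbertBasis.coe_mk]
  exact coeFn_expLp _ _
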